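/- Let $\ell\in\frac12\mathbb{Z}_{\ge0}$ and index the rows and columns of $(2\ell+1)\times(2\ell+1)$-matrices by $0,1,\dots,2\ell$. Write $(a)_n=a(a+1)\cdots(a+n-1)$, let ${}_pF_q$ denote the hypergeometric series, let $U_n$ be the Chebyshev polynomials of the second kind, and put $C^{(\alpha)}_n(x)=\frac{(2\alpha)_n}{n!}\,{}_2F_1\left(-n,n+2\alpha;\alpha+\tfrac12;\tfrac{1-x}{2}\right)$ (Gegenbauer polynomials) and $R_k(\lambda(t);\alpha,\beta,\gamma,\delta)={}_4F_3\left(-k,k+\alpha+\beta+1,-t,t+\gamma+\delta+1;\alpha+1,\beta+\delta+1,\gamma+1;1\right)$, $\lambda(t)=t(t+\gamma+\delta+1)$ (Racah polynomials). Let $W$ be the symmetric matrix-valued weight on $[-1,1]$ given for $m\le n$ by $$W(x)_{n,m}=W(x)_{m,n}=\sqrt{1-x^2}\,\sum_{t=0}^m\alpha_t(m,n)\,U_{n+m-2t}(x),$$ $$\alpha_t(m,n)=\frac{2\ell+1}{n+1}\,\frac{(2\ell-m)!\,m!}{(2\ell)!}\,(-1)^{m-t}\,\frac{(n-2\ell)_{m-t}}{(n+2)_{m-t}}\,\frac{(2\ell+2-t)_t}{t!}.$$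 Then the monic matrix-valued orthogonal polynomials $(P_n)_{n\ge0}$ for $W$ exist: $P_n$ is a polynomial of degree $n$ with coefficients in $M_{2\ell+1}(\mathbb{C})$ and leading coefficient $I$, and $\int_{-1}^1P_n(x)W(x)P_m(x)^*\,dx=\delta_{nm}H_n$ with $H_n$ positive definite. Let $L(x)$ be the lower triangular matrix with $$L(x)_{mk}=\frac{m!\,(2k+1)!}{(m+k+1)!\,k!}\,C^{(k+1)}_{m-k}(x)\quad(k\le m),\qquad L(x)_{mk}=0\quad(k>m),$$ and put $R_n(u)=(-1)^n2^{-n}P_n(1-2u)$, $M(u)=L(1-2u)$ and $$c_{k,0}(n)=(-1)^n4^{-n}\,\frac{n!\,(2\ell+2)_n}{(k+1)_n\,(2\ell-k+1)_n}.$$ Then for all $n\ge0$ and $k,j\in\{0,\dots,2\ell\}$ with $j\le k+n$, identically in $u$, $$\bigl(R_n(u)M(u)\bigr)_{kj}=c_{k,0}(n)\,(-1)^j\,\frac{(-2\ell)_j\,(-k-n)_j}{j!\,(2\ell+2)_j}\;{}_4F_3\left(-j,j+1,-k,-2\ell-n-1;\,1,-k-n,-2\ell;\,1\right)\;{}_2F_1\left(j-k-n,n+k+j+2;\,j+\tfrac32;\,u\right),$$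 and $(R_n(u)M(u))_{kj}=0$ if $j>k+n$. Equivalently, identically in $x$, for $j\le k+n$, $$\bigl(P_n(x)L(x)\bigr)_{kj}=(-2)^n\,c_{k,0}(n)\,(-1)^j\,\frac{(-2\ell)_j\,(-k-n)_j}{j!\,(2\ell+2)_j}\;R_k(\lambda(j);-2\ell-1,-k-n-1,0,0)\;\frac{(n+k-j)!}{(2j+2)_{n+k-j}}\;C^{(j+1)}_{n+k-j}(x),$$ and $(P_n(x)L(x))_{kj}=0$ if $j>k+n$. -/

import Mathlib

open scoped Nat Matrix

namespace MVChebyshev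

noncomputable section

open scoped ComplexOrder

/-- The Pochhammer symbol `(a)_n = a (a+1) ⋯ (a+n-1)`. -/
def poch (a : ℂ) (n : ℕ) : ℂ := (ascPochhammer ℂ n).eval a

/-- The hypergeometric series `₄F₃(a₁,a₂,a₃,a₄; b₁,b₂,b₃; z)`. -/
def hyp4F3 (a₁ a₂ a₃ a₄ b₁ b₂ b₃ z : ℂ) : ℂ :=
  ∑' i : ℕ, (poch a₁ i * poch a₂ i * poch a₃ i * poch a₄ i) /
    (poch b₁ i * poch b₂ i * poch b₃ i * (i ! : ℂ)) * z ^ i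

/-- The Racah polynomial `R_k(λ(t); α, β, γ, δ)`, where `λ(t) = t (t+γ+δ+1)`. -/
def racah (k t : ℕ) (α β γ δ : ℂ) : ℂ :=
  hyp4F3 (-k) (k + α + β + 1) (-t) (t + γ + δ + 1) (α + 1) (β + δ + 1) (γ + 1) 1

/-- The Gegenbauer polynomial `C_n^{(α)}(x)`. -/
def gegenbauer (α : ℂ) (n : ℕ) (x : ℂ) : ℂ :=
  poch (2 * α) n / (n ! : ℂ) *
    ordinaryHypergeometric (-(n : ℂ)) (n + 2 * α) (α + 1 / 2) ((1 - x) / 2)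

/-- The coefficients `α_t(m,n)` of the weight, for `t ≤ m ≤ n ≤ N`, with `N = 2ℓ`. -/
def weightCoeff (N t m n : ℕ) : ℝ :=
  ((N : ℝ) + 1) / (n + 1) * (((N - m)! : ℝ) * (m ! : ℝ) / (N ! : ℝ)) * (-1) ^ (m - t) *
    ((ascPochhammer ℝ (m - t)).eval ((n : ℝ) - N) / (ascPochhammer ℝ (m - t)).eval ((n : ℝ) + 2)) *
    ((ascPochhammer ℝ t).eval ((N : ℝ) + 2 - t) / (t ! : ℝ))

/-- The `(n,m)` entry of the weight for `m ≤ n`. -/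
def weightEntry (N n m : ℕ) (x : ℝ) : ℝ :=
  √(1 - x ^ 2) * ∑ t ∈ Finset.range (m + 1),
    weightCoeff N t m n * (Polynomial.Chebyshev.U ℝ ((n : ℤ) + m - 2 * t)).eval x

/-- The symmetric matrix weight `W` on `[-1,1]`, of size `N + 1 = 2ℓ + 1`. -/
def W (N : ℕ) (x : ℝ) : Matrix (Fin (N + 1)) (Fin (N + 1)) ℂ :=
  Matrix.of fun n m =>
    if m ≤ n then (weightEntry N n m x : ℂ) else (weightEntry N m n x : ℂ)

/-- The value at `x` of a matrix of polynomials. -/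
def evalMat {N : ℕ} (P : Matrix (Fin (N + 1)) (Fin (N + 1)) (Polynomial ℂ)) (x : ℂ) :
    Matrix (Fin (N + 1)) (Fin (N + 1)) ℂ :=
  P.map fun p => p.eval x

/-- The matrix-valued inner product `⟨P, Q⟩_W = ∫_{-1}^1 P(x) W(x) Q(x)^* dx`. -/
def innerW {N : ℕ} (P Q : Matrix (Fin (N + 1)) (Fin (N + 1)) (Polynomial ℂ)) :
    Matrix (Fin (N + 1)) (Fin (N + 1)) ℂ :=
  Matrix.of fun i j =>
    ∫ x in (-1 : ℝ)..1, (evalMat P (x : ℂ) * W N x * (evalMat Q (x : ℂ))ᴴ) i j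

/-- `P` is the sequence of monic matrix-valued orthogonal polynomials for `W`:
`P n` has degree `n` and leading coefficient `I`, and `⟨P n, P m⟩_W = δ_{nm} H_n`
with `H_n` positive definite. -/
structure IsMonicMVOP (N : ℕ)
    (P : ℕ → Matrix (Fin (N + 1)) (Fin (N + 1)) (Polynomial ℂ)) : Prop where
  natDegree_le : ∀ n i j, (P n i j).natDegree ≤ n
  monic : ∀ n, (P n).map (fun p => p.coeff n) = 1
  orthogonal : ∃ H : ℕ → Matrix (Fin (N + 1)) (Fin (N + 1)) ℂ,
    (∀ n, (H n).PosDef) ∧ ∀ n m, innerW (P n) (P m) = if n = m then H n else 0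

/-- The unipotent lower triangular factor `L(x)` of the weight. -/
def L (N : ℕ) (x : ℂ) : Matrix (Fin (N + 1)) (Fin (N + 1)) ℂ :=
  Matrix.of fun m k =>
    if k ≤ m then
      ((m : ℕ)! : ℂ) * ((2 * (k : ℕ) + 1)! : ℂ) /
          ((((m : ℕ) + (k : ℕ) + 1)! : ℂ) * ((k : ℕ)! : ℂ)) *
        gegenbauer ((k : ℕ) + 1) ((m : ℕ) - (k : ℕ)) x
    else 0

/-- `M(u) = L(1 - 2u)`. -/
def M (N : ℕ) (u : ℂ) : Matrix (Fin (N + 1)) (Fin (N + 1)) ℂ := L N (1 - 2 * u)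

/-- `R_n(u) = (-1)^n 2^{-n} P_n(1 - 2u)`. -/
def R {N : ℕ} (P : ℕ → Matrix (Fin (N + 1)) (Fin (N + 1)) (Polynomial ℂ)) (n : ℕ) (u : ℂ) :
    Matrix (Fin (N + 1)) (Fin (N + 1)) ℂ :=
  ((-1 : ℂ) ^ n * ((2 : ℂ) ^ n)⁻¹) • evalMat (P n) (1 - 2 * u)

/-- The constant `c_{k,0}(n) = (-1)^n 4^{-n} n! (2ℓ+2)_n / ((k+1)_n (2ℓ-k+1)_n)`, `N = 2ℓ`. -/
def c₀ (N k n : ℕ) : ℂ :=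
  (-1) ^ n * ((4 : ℂ) ^ n)⁻¹ *
    ((n ! : ℂ) * poch (N + 2) n / (poch (k + 1) n * poch (N - k + 1) n))

end

end MVChebyshev

/-! Put `N = 2ℓ`. The proof constructs the monic orthogonal polynomials with their product by `L`
already known, then shows that nothing else is orthogonal.

The weight factors as `W = L T Lᵗ` with `T` diagonal (`ldu_eq_chebEntry`, `W_eq`, `polyW_apply`).
The entries of `L` are multiples of the derivatives `U_k^{(j)}`, that is, of Gegenbauer polynomials,
and the `j`-th diagonal entry of `T` is a multiple of `(1 - x²)^{j + 1/2}`, for which the `j`-th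
derivatives are orthogonal. The factorization is proved by induction on `N`: both sides obey one
recurrence in `N` and the row index, so only two corner entries need direct computation.

The candidate for the `(k,j)` entry of `P_n L` is a Racah-type sum `racahCoeff N n k j` times
`L_{n+k,j}`. Multiplication by `x` moves the level `n + k` by one in either direction. Level `n + k
+ 1` is shared by the entries `(n+1,k)` and `(n,k+1)`, level `n + k - 1` by `(n,k-1)` and `(n-1,k)`,
so the matrix three-term recurrence splits into two contiguous relations for the Racah sums,
`racahCoeff_raise` and `racahCoeff_lower`. Its coefficients do not depend on `j`, so the same
recurrence defines matrix polynomials `mvop`, and `mvop N n * L` has the candidate entries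
(`mvop_mul_matL`).

For orthogonality, Gegenbauer orthogonality kills every entry of `∫ P_n W` except those with column
`n + k`; these obey a recurrence that makes them vanish for `n ≥ 1` (`moment_mvop_succ`). The
three-term recurrence then gives all moments `∫ x^m P_n W` with `m ≤ n`, with positive diagonal
norms. Uniqueness (`IsMonicMVOP.eq_mvop`) carries the formula to an arbitrary monic orthogonal
sequence, and the rest is translation into hypergeometric notation. -/

namespace MVChebyshev

noncomputable section

open scoped ComplexOrder
open Polynomial
open Polynomial.Chebyshev (U U_add_one U_zero U_neg_sub_two T_derivative_eq_U
  two_mul_T_eq_U_sub_U one_sub_X_sq_mul_iterate_derivative_U_eq_poly_in_U)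

/-! ### Derivatives of Chebyshev polynomials: differential equation and recurrences. -/

/-- The `j`-th derivative of the Chebyshev polynomial `U_n`. -/
def dU (j : ℕ) (n : ℤ) : ℂ[X] := derivative^[j] (U ℂ n)

lemma derivative_dU (j : ℕ) (n : ℤ) : derivative (dU j n) = dU (j + 1) n := by
  simp [dU, Function.iterate_succ_apply']

lemma dU_zero (n : ℤ) : dU 0 n = U ℂ n := rfl

lemma dU_ode (j : ℕ) (n : ℤ) :
    (1 - X ^ 2) * dU (j + 2) n = (2 * j + 3 : ℂ[X]) * X * dU (j + 1) n -
      ((n + 1) ^ 2 - (j + 1) ^ 2 : ℂ[X]) * dU j n :=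
  one_sub_X_sq_mul_iterate_derivative_U_eq_poly_in_U n j

lemma derivative_U_add_one_sub (n : ℤ) :
    dU 1 (n + 1) - dU 1 (n - 1) = 2 * (n + 1 : ℂ[X]) * dU 0 n := by
  have h := congr_arg derivative (two_mul_T_eq_U_sub_U ℂ (n - 1))
  rw [show n - 1 + 2 = n + 1 by ring] at h
  simp only [derivative_mul, derivative_sub, T_derivative_eq_U, derivative_ofNat] at h
  simp only [dU, Function.iterate_one, Function.iterate_zero, id_eq]
  rw [← h]
  simp
  ring

lemma dU_succ_add_one_sub (j : ℕ) (n : ℤ) :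
    dU (j + 1) (n + 1) - dU (j + 1) (n - 1) = 2 * (n + 1 : ℂ[X]) * dU j n := by
  induction j with
  | zero => exact derivative_U_add_one_sub n
  | succ j ih =>
    have h := congr_arg derivative ih
    simpa [derivative_mul, derivative_dU] using h

lemma two_mul_X_mul_dU (j : ℕ) (n : ℤ) :
    2 * X * dU (j + 1) n + 2 * (j + 1 : ℂ[X]) * dU j n =
      dU (j + 1) (n + 1) + dU (j + 1) (n - 1) := by
  induction j with
  | zero =>
    have h := congr_arg derivative (U_add_one ℂ n)
    simp only [derivative_sub, derivative_mul, ← dU_zero, derivative_dU] at h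
    simp at h
    simp
    linear_combination -h
  | succ j ih =>
    have h := congr_arg derivative ih
    simp [derivative_mul, derivative_dU] at h
    push_cast
    linear_combination h

/-- The Gegenbauer three-term recurrence: for `j > 0` it results from eliminating the lower
derivative between `two_mul_X_mul_dU` and `dU_succ_add_one_sub`. -/
lemma dU_three_term (j : ℕ) (n : ℤ) :
    2 * (n + 1 : ℂ[X]) * X * dU j n =
      (n - j + 1 : ℂ[X]) * dU j (n + 1) + (n + j + 1 : ℂ[X]) * dU j (n - 1) := by
  cases j with
  | zero =>
    have h := U_add_one ℂ n
    simp only [dU_zero]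
    push_cast
    linear_combination -(n + 1 : ℂ[X]) * h
  | succ j =>
    have h1 := two_mul_X_mul_dU j n
    have h2 := dU_succ_add_one_sub j n
    push_cast
    linear_combination (n + 1 : ℂ[X]) * h1 + (j + 1 : ℂ[X]) * h2

lemma dU_eq_zero {j n : ℕ} (h : n < j) : dU j n = 0 :=
  iterate_derivative_eq_zero (by simpa using h)

/-! ### The semicircle functional and Gegenbauer orthogonality. -/

/-- The functional `f ↦ ∫ √(1 - x²) f(x) dx` over `[-1, 1]`. -/
def semicircle : ℂ[X] →ₗ[ℂ] ℂ where
  toFun f := ∫ x in (-1 : ℝ)..1, (√(1 - x ^ 2) : ℂ) * f.eval (x : ℂ)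
  map_add' f g := by
    rw [← intervalIntegral.integral_add]
    · simp [mul_add]
    all_goals
      apply Continuous.intervalIntegrable
      fun_prop
  map_smul' c f := by
    rw [RingHom.id_apply, smul_eq_mul, ← intervalIntegral.integral_const_mul]
    congr 1 with x
    simp
    ring

lemma semicircle_apply (f : ℂ[X]) :
    semicircle f = ∫ x in (-1 : ℝ)..1, (√(1 - x ^ 2) : ℂ) * f.eval (x : ℂ) := rfl

lemma semicircle_one : semicircle 1 = (Real.pi / 2 : ℝ) := by
  rw [semicircle_apply, ← integral_sqrt_one_sub_sq, ← intervalIntegral.integral_ofReal]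
  simp

lemma semicircle_C_mul (c : ℂ) (f : ℂ[X]) : semicircle (C c * f) = c * semicircle f := by
  rw [← smul_eq_C_mul, map_smul, smul_eq_mul]

/-- The integrand is the derivative of `(1 - x²)^{3/2} f`, which vanishes at both endpoints. -/
lemma semicircle_by_parts (f : ℂ[X]) :
    semicircle ((1 - X ^ 2) * derivative f - 3 * X * f) = 0 := by
  have hd : ∀ x ∈ Set.Ioo (-1 : ℝ) 1, HasDerivAt
      (fun x : ℝ => ((√(1 - x ^ 2) : ℝ) : ℂ) * ((1 - X ^ 2) * f).eval (x : ℂ))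
      ((√(1 - x ^ 2) : ℂ) * ((1 - X ^ 2) * derivative f - 3 * X * f).eval (x : ℂ)) x := by
    intro x hx
    have hpos : 0 < 1 - x ^ 2 := by nlinarith [hx.1, hx.2]
    have h1 : HasDerivAt (fun x : ℝ => √(1 - x ^ 2)) ((-(2 * x)) / (2 * √(1 - x ^ 2))) x := by
      have h0 : HasDerivAt (fun x : ℝ => 1 - x ^ 2) (-(2 * x)) x := by
        simpa using ((hasDerivAt_pow 2 x).const_sub 1)
      exact h0.sqrt hpos.ne'
    have h2 := (((1 - X ^ 2) * f).hasDerivAt (x : ℂ)).comp_ofReal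
    have h3 := h1.ofReal_comp.mul h2
    refine h3.congr_deriv ?_
    have hs : ((√(1 - x ^ 2) : ℝ) : ℂ) ≠ 0 := by
      exact_mod_cast (Real.sqrt_pos.2 hpos).ne'
    have hs2 : ((√(1 - x ^ 2) : ℝ) : ℂ) ^ 2 = 1 - (x : ℂ) ^ 2 := by
      exact_mod_cast Real.sq_sqrt hpos.le
    simp
    field_simp
    linear_combination (f.eval (x : ℂ) * x) * hs2
  rw [semicircle_apply, intervalIntegral.integral_eq_sub_of_hasDerivAt_of_le (by norm_num) _ hd]
  · simp
  · apply Continuous.intervalIntegrable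
    fun_prop
  · apply Continuous.continuousOn
    fun_prop

/-- Sturm–Liouville argument: integrate by parts the weighted Wronskian of two solutions of
`dU_ode`. What remains is the product times the difference of eigenvalues `(q+1)² - (p+1)²`, nonzero
for `p ≠ q`. -/
lemma semicircle_dU_mul_dU (j : ℕ) {p q : ℕ} (hpq : p ≠ q) :
    semicircle ((1 - X ^ 2) ^ j * dU j p * dU j q) = 0 := by
  have h := semicircle_by_parts
    ((1 - X ^ 2) ^ j * (dU (j + 1) p * dU j q - dU j p * dU (j + 1) q))
  have e : (1 - X ^ 2) * derivative
        ((1 - X ^ 2) ^ j * (dU (j + 1) p * dU j q - dU j p * dU (j + 1) q)) -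
      3 * X * ((1 - X ^ 2) ^ j * (dU (j + 1) p * dU j q - dU j p * dU (j + 1) q)) =
      C ((q + 1 : ℂ) ^ 2 - (p + 1) ^ 2) * ((1 - X ^ 2) ^ j * dU j p * dU j q) := by
    have hp := dU_ode j p
    have hq := dU_ode j q
    have hd : (1 - X ^ 2) * derivative ((1 - X ^ 2 : ℂ[X]) ^ j) =
        -(2 * (j : ℂ[X]) * X) * (1 - X ^ 2) ^ j := by
      cases j with
      | zero => simp
      | succ j =>
        have h2 : (C 2 : ℂ[X]) = 2 := rfl
        simp [derivative_pow, h2]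
        ring
    simp only [derivative_mul, derivative_sub, derivative_dU]
    push_cast at hp hq
    simp
    linear_combination (dU (j + 1) p * dU j q - dU j p * dU (j + 1) q) * hd +
      (1 - X ^ 2) ^ j * (dU j q * hp - dU j p * hq)
  rw [e, semicircle_C_mul] at h
  refine (mul_eq_zero.1 h).resolve_left fun h0 => hpq ?_
  have h1 : ((q + 1) ^ 2 : ℕ) = (p + 1) ^ 2 := by
    exact_mod_cast sub_eq_zero.1 h0
  have := Nat.pow_left_injective (n := 2) (by norm_num) h1
  simp at this
  omega

lemma semicircle_U {r : ℕ} (hr : r ≠ 0) : semicircle (U ℂ r) = 0 := by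
  simpa [dU_zero] using semicircle_dU_mul_dU 0 hr

/-! ### The factored form of the weight. -/

/-- Reciprocal factorials, extended by zero to negative integers. -/
def invFac (z : ℤ) : ℂ := if 0 ≤ z then ((z.toNat)! : ℂ)⁻¹ else 0

lemma invFac_natCast (n : ℕ) : invFac n = (n ! : ℂ)⁻¹ := by simp [invFac]

lemma invFac_of_neg {z : ℤ} (h : z < 0) : invFac z = 0 := by simp [invFac, h]

/-- Validity at every integer, including `z ≤ 0`, lets the later coefficient identities hold without
boundary cases. -/
lemma invFac_sub_one (z : ℤ) : invFac (z - 1) = z * invFac z := by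
  rcases lt_trichotomy z 0 with h | h | h
  · rw [invFac_of_neg h, invFac_of_neg (by omega), mul_zero]
  · subst h
    simp [invFac]
  · obtain ⟨n, rfl⟩ : ∃ n : ℕ, z = n + 1 := ⟨(z - 1).toNat, by omega⟩
    rw [add_sub_cancel_right, invFac_natCast, show (n : ℤ) + 1 = (n + 1 : ℕ) by simp,
      invFac_natCast, Nat.factorial_succ]
    have : (n : ℂ) + 1 ≠ 0 := by exact_mod_cast n.succ_ne_zero
    have : (n ! : ℂ) ≠ 0 := by exact_mod_cast n.factorial_ne_zero
    push_cast
    field_simp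

lemma factorial_ne_zero' (n : ℕ) : (n ! : ℂ) ≠ 0 := by exact_mod_cast n.factorial_ne_zero

/-- The functions `n! / (n+j+1)! U_n^{(j)}`, proportional to the entries of `L`. -/
def ell (n j : ℕ) : ℂ[X] := C ((n ! : ℂ) / (n + j + 1)!) * dU j n

lemma ell_eq_zero {n j : ℕ} (h : n < j) : ell n j = 0 := by simp [ell, dU_eq_zero h]

/-- The factor `n! / (n+j+1)!` is chosen so that the lowering coefficient is free of `j` and the
raising one depends on `j` only through `j(j+1)`. At `n = 0` the truncated index `n - 1` carries
coefficient zero. -/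
lemma X_mul_ell (n j : ℕ) :
    X * ell n j = C (((n + 1 : ℂ) * (n + 2) - j * (j + 1)) / (2 * (n + 1) ^ 2)) * ell (n + 1) j +
      C ((n : ℂ) / (2 * (n + 1))) * ell (n - 1) j := by
  have h := dU_three_term j n
  have hn : (n : ℂ) + 1 ≠ 0 := by exact_mod_cast n.succ_ne_zero
  have hj : (n : ℂ) + j + 1 ≠ 0 := by exact_mod_cast (n + j).succ_ne_zero
  have hj2 : (n : ℂ) + j + 2 ≠ 0 := by exact_mod_cast (n + j + 1).succ_ne_zero
  have hc : X * dU j n = C (((n : ℂ) - j + 1) / (2 * (n + 1))) * dU j (n + 1 : ℕ) +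
      C (((n : ℂ) + j + 1) / (2 * (n + 1))) * dU j ((n : ℤ) - 1) := by
    have h2 : C (2 * ((n : ℂ) + 1)) ≠ 0 := C_ne_zero.2 (by simpa using hn)
    apply mul_left_cancel₀ h2
    rw [mul_add (C _), ← mul_assoc (C _) (C _), ← mul_assoc (C _) (C _), ← C_mul, ← C_mul,
      mul_div_cancel₀ _ (by simpa using hn), mul_div_cancel₀ _ (by simpa using hn)]
    have h2' : (C 2 : ℂ[X]) = 2 := rfl
    simp [h2'] at h ⊢
    linear_combination h
  have e1 : (n ! : ℂ) / (n + j + 1)! * ((n - j + 1) / (2 * (n + 1))) =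
      ((n + 1 : ℂ) * (n + 2) - j * (j + 1)) / (2 * (n + 1) ^ 2) *
        ((n + 1)! / (n + 1 + j + 1)!) := by
    rw [show n + 1 + j + 1 = (n + j + 1) + 1 by ring, Nat.factorial_succ (n + j + 1),
      Nat.factorial_succ n]
    have := factorial_ne_zero' (n + j + 1)
    push_cast
    rw [show (n : ℂ) + j + 1 + 1 = n + j + 2 by ring]
    field_simp
    ring
  calc X * ell n j = C ((n ! : ℂ) / (n + j + 1)!) * (X * dU j n) := by rw [ell]; ring
    _ = C ((n ! : ℂ) / (n + j + 1)! * ((n - j + 1) / (2 * (n + 1)))) * dU j (n + 1 : ℕ) +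
        C ((n ! : ℂ) / (n + j + 1)! * ((n + j + 1) / (2 * (n + 1)))) * dU j ((n : ℤ) - 1) := by
      rw [hc, C_mul, C_mul]; ring
    _ = _ := by
      rw [e1]
      congr 1
      · rw [ell, C_mul]; ring
      · rcases n with _ | n
        · simp [dU]
        · rw [ell, ← mul_assoc, ← C_mul]
          congr 2
          · rw [show n + 1 + j + 1 = (n + j + 1) + 1 by ring, Nat.factorial_succ (n + j + 1),
              Nat.factorial_succ n]
            have := factorial_ne_zero' (n + j + 1)
            rw [show n + 1 - 1 + j + 1 = n + j + 1 by simp, Nat.add_sub_cancel]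
            push_cast at hj ⊢
            rw [show (n : ℂ) + j + 1 + 1 = n + 1 + j + 1 by ring]
            field_simp
          · simp

/-- Sum form of the entries of `L T Lᵗ`, up to the factor `N!²`. -/
def ldu (N n m : ℕ) : ℂ[X] :=
  ∑ j ∈ Finset.range (N + 1),
    C ((2 * j + 1) * (N + j + 1)! * (N - j)! : ℂ) * (1 - X ^ 2) ^ j * ell n j * ell m j

lemma ldu_comm (N n m : ℕ) : ldu N n m = ldu N m n :=
  Finset.sum_congr rfl fun j _ => by ring

/-- Passing from `N` to `N + 1` multiplies the `j`-th diagonal factor by `(N+1)(N+2) - j(j+1)`. The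
`j(j+1)` is traded for multiplication by `x` through `X_mul_ell`, leaving coefficients free of `j`.
The new summand `j = N + 1` vanishes because `m ≤ N`. -/
lemma ldu_rec {N m : ℕ} (n : ℕ) (hm : m ≤ N) :
    ldu (N + 1) (n + 1) m = C (2 * (n + 1) ^ 2 : ℂ) * X * ldu N n m -
      C ((n : ℂ) * (n + 1)) * ldu N (n - 1) m -
      C ((n + 1 : ℂ) * (n + 2) - (N + 1) * (N + 2)) * ldu N (n + 1) m := by
  have hn : (n : ℂ) + 1 ≠ 0 := by exact_mod_cast n.succ_ne_zero
  rw [ldu, Finset.sum_range_succ, ell_eq_zero (show m < N + 1 by omega)]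
  simp only [ldu, Finset.mul_sum, mul_zero, add_zero, ← Finset.sum_sub_distrib]
  refine Finset.sum_congr rfl fun j hj => ?_
  have hj : j ≤ N := by simpa [Nat.lt_succ_iff] using hj
  have e1 : ((N + 1 + j + 1)! : ℂ) * (N + 1 - j)! =
      ((N + 1) * (N + 2) - j * (j + 1)) * ((N + j + 1)! * (N - j)!) := by
    rw [show N + 1 + j + 1 = (N + j + 1) + 1 by ring, Nat.factorial_succ (N + j + 1),
      show N + 1 - j = (N - j) + 1 by omega, Nat.factorial_succ (N - j)]
    push_cast [hj]
    ring
  have e2 := X_mul_ell n j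
  have e3 : C (2 * (n + 1 : ℂ) ^ 2) * (X * ell n j) =
      C ((n + 1 : ℂ) * (n + 2) - j * (j + 1)) * ell (n + 1) j +
        C ((n : ℂ) * (n + 1)) * ell (n - 1) j := by
    rw [e2, mul_add (C _), ← mul_assoc, ← mul_assoc, ← C_mul, ← C_mul]
    congr 2 <;> congr 1 <;> field_simp
  have e4 : C ((2 * j + 1) * (N + 1 + j + 1)! * (N + 1 - j)! : ℂ) =
      (C ((N + 1 : ℂ) * (N + 2)) - C ((j : ℂ) * (j + 1))) *
        C ((2 * j + 1) * (N + j + 1)! * (N - j)! : ℂ) := by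
    rw [← C_sub, ← C_mul]
    congr 1
    linear_combination (2 * j + 1 : ℂ) * e1
  rw [e4]
  simp only [C_sub] at e3 ⊢
  linear_combination -(C ((2 * j + 1) * (N + j + 1)! * (N - j)! : ℂ) * (1 - X ^ 2) ^ j *
    ell m j) * e3

/-- The derivative telescopes in `j`, so the entry is constant; at `x = 1` only the summand `j = 0`
survives. -/
lemma ldu_self (N : ℕ) : ldu N N N = C ((N ! : ℂ) * (N + 1)!) := by
  -- The telescoping potential: `dU_ode` turns the derivative of the `j`-th summand into `h (j+1) -
  -- h j`. The factor `2j` gives `h 0 = 0`, and `U_N^{(N+1)} = 0` gives `h (N+1) = 0`.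
  let h : ℕ → ℂ[X] := fun j => C ((N ! : ℂ) ^ 2 * (2 * j) * (N + 1 - j)! / (N + j)!) *
    (1 - X ^ 2) ^ (j - 1) * dU j N * dU (j - 1) N
  have hd : derivative (ldu N N N) = 0 := by
    have : derivative (ldu N N N) = ∑ j ∈ Finset.range (N + 1), (h (j + 1) - h j) := by
      rw [ldu, derivative_sum]
      refine Finset.sum_congr rfl fun j hj => ?_
      have hj : j ≤ N := by simpa [Nat.lt_succ_iff] using hj
      have f1 := factorial_ne_zero' (N + j)
      have hj1 : (N : ℂ) + j + 1 ≠ 0 := by exact_mod_cast (N + j).succ_ne_zero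
      set e : ℂ := (N ! : ℂ) ^ 2 * (N - j)! / (N + j + 1)! with he
      have e1 : C ((2 * j + 1) * (N + j + 1)! * (N - j)! : ℂ) * (1 - X ^ 2) ^ j * ell N j *
          ell N j = C ((2 * j + 1) * e) * ((1 - X ^ 2) ^ j * dU j N * dU j N) := by
        have : (2 * j + 1) * e = ((2 * j + 1) * (N + j + 1)! * (N - j)! : ℂ) *
            ((N ! : ℂ) / (N + j + 1)!) * ((N ! : ℂ) / (N + j + 1)!) := by
          have := factorial_ne_zero' (N + j + 1)
          rw [he]
          field_simp
        rw [this, ell]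
        simp only [C_mul]
        ring
      have e2 : h (j + 1) = C (2 * (j + 1) * e) * ((1 - X ^ 2) ^ j * dU (j + 1) N * dU j N) := by
        have : (N ! : ℂ) ^ 2 * (2 * (j + 1 : ℕ)) * (N + 1 - (j + 1))! / (N + (j + 1))! =
            2 * (j + 1) * e := by
          rw [he, Nat.add_sub_add_right, ← add_assoc]
          push_cast
          ring
        simp only [h, this, Nat.add_sub_cancel]
        ring
      rw [e1, e2]
      rcases j with _ | j
      · simp [h, derivative_mul, derivative_dU]
        have h2 : (C 2 : ℂ[X]) = 2 := rfl
        rw [h2]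
        ring
      · have e3 : h (j + 1) = C (2 * (j + 1) * (((N + 1) ^ 2 - (j + 1) ^ 2) * e)) *
            ((1 - X ^ 2) ^ j * dU (j + 1) N * dU j N) := by
          have : (N ! : ℂ) ^ 2 * (2 * (j + 1 : ℕ)) * (N + 1 - (j + 1))! / (N + (j + 1))! =
              2 * (j + 1) * (((N + 1) ^ 2 - (j + 1) ^ 2) * e) := by
            rw [he, show N + 1 - (j + 1) = N - (j + 1) + 1 by omega, Nat.factorial_succ,
              Nat.factorial_succ (N + (j + 1))]
            push_cast [hj] at hj1 ⊢
            field_simp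
            ring
          simp only [h, this, Nat.add_sub_cancel]
          ring
        have ode := dU_ode j N
        have h2 : (C 2 : ℂ[X]) = 2 := rfl
        rw [e3]
        simp only [derivative_mul, derivative_dU, derivative_pow]
        simp [h2] at ode ⊢
        linear_combination (2 * (j + 1 : ℂ[X]) * C e * (1 - X ^ 2) ^ j * dU (j + 1) N) * ode
    rw [this, Finset.sum_range_sub]
    simp [h, dU_eq_zero]
  have hc := eq_C_of_natDegree_eq_zero (derivative_eq_zero.1 hd)
  have he : (ldu N N N).eval 1 = (N ! : ℂ) * (N + 1)! := by
    rw [ldu, eval_finsetSum, Finset.sum_eq_single 0]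
    · have := factorial_ne_zero' (N + 1)
      have := factorial_ne_zero' N
      have hn : (N : ℂ) + 1 ≠ 0 := by exact_mod_cast N.succ_ne_zero
      simp [ell, dU_zero]
      rw [Nat.factorial_succ]
      push_cast
      field_simp
    · intro j _ hj
      simp [hj]
    · simp
  rw [hc, eval_C] at he
  rw [hc, he]

/-! ### The Chebyshev expansion of the weight, and equality of the two forms. -/

/-- The coefficient of `U_{r-2t}`, `r = n + m`, in the weight, up to normalization. -/
def chebCoeff (N : ℕ) (r t : ℤ) : ℂ :=
  invFac t * invFac (r + 1 - t) * invFac (N + 1 - t) * invFac (N - r + t)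

/-- The reflection `t ↦ r + 1 - t` preserves the range and the coefficient but changes the sign of
`U_{r-2t}`, as `U_{-s-2} = -U_s`; hence the sum equals its own negative. -/
lemma sum_Ico_chebCoeff (N a b : ℕ) (r : ℤ) (h : (a : ℤ) + b = r + 2) :
    ∑ t ∈ Finset.Ico a b, C (chebCoeff N r t) * U ℂ (r - 2 * t) = 0 := by
  have h1 : ∑ t ∈ Finset.Ico a b, C (chebCoeff N r t) * U ℂ (r - 2 * t) =
      ∑ t ∈ Finset.Ico a b, -(C (chebCoeff N r t) * U ℂ (r - 2 * t)) := by
    refine Finset.sum_bij' (fun t _ => a + b - 1 - t) (fun t _ => a + b - 1 - t) ?_ ?_ ?_ ?_ ?_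
    · intro t ht; simp only [Finset.mem_Ico] at ht ⊢; omega
    · intro t ht; simp only [Finset.mem_Ico] at ht ⊢; omega
    · intro t ht; simp only [Finset.mem_Ico] at ht ⊢; omega
    · intro t ht; simp only [Finset.mem_Ico] at ht ⊢; omega
    · intro t ht
      simp only [Finset.mem_Ico] at ht
      have e : ((a + b - 1 - t : ℕ) : ℤ) = r + 1 - t := by omega
      rw [e, show r - 2 * (r + 1 - (t : ℤ)) = -(r - 2 * t) - 2 by ring, U_neg_sub_two]
      rw [show chebCoeff N r (r + 1 - t) = chebCoeff N r t by
        simp only [chebCoeff]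
        rw [show r + 1 - (r + 1 - (t : ℤ)) = t by ring,
          show (N : ℤ) + 1 - (r + 1 - t) = N - r + t by ring,
          show (N : ℤ) - r + (r + 1 - t) = N + 1 - t by ring]
        ring]
      ring
  rw [Finset.sum_neg_distrib] at h1
  exact self_eq_neg.1 h1

/-- The truncated Chebyshev expansion in the entries of the weight. -/
def chebSum (N : ℕ) (r : ℤ) (h : ℕ) : ℂ[X] :=
  ∑ t ∈ Finset.range (h + 1), C (chebCoeff N r t) * U ℂ (r - 2 * t)

/-- The terms between the two truncation points form a range symmetric under the reflection, so they
cancel. -/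
lemma chebSum_comm (N n m : ℕ) : chebSum N (n + m) m = chebSum N (n + m) n := by
  wlog hmn : m ≤ n generalizing n m
  · rw [add_comm, this m n (by omega)]
  have := sum_Ico_chebCoeff N (m + 1) (n + 1) (n + m) (by push_cast; ring)
  rw [Finset.sum_Ico_eq_sub _ (by omega)] at this
  exact (sub_eq_zero.1 this).symm

lemma chebSum_sub_one (N m : ℕ) : chebSum N ((m : ℤ) - 1) m = 0 := by
  have := sum_Ico_chebCoeff N 0 (m + 1) (m - 1) (by push_cast; ring)
  rwa [← Finset.range_eq_Ico] at this

lemma chebSum_eq_zero (N m : ℕ) : chebSum N ((N : ℤ) + 1 + m) m = 0 := by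
  refine Finset.sum_eq_zero fun t ht => ?_
  have : t ≤ m := by simpa [Nat.lt_succ_iff] using ht
  rw [chebCoeff, invFac_of_neg (z := (N : ℤ) - (N + 1 + m) + t) (by omega)]
  simp

/-- In the notation of `chebSum_rec` this is `f t = -g (t + 1)`, which makes the sum there
telescope. All terms are reduced to the same four reciprocal factorials. -/
lemma chebCoeff_rec (N : ℕ) (n m t : ℤ) :
    (n + 1) * chebCoeff N (n + m) t - (N - n + 1) * chebCoeff N (n + m - 1) t =
      -((n + 1) * chebCoeff N (n + m) (t + 1) +
        (N + n + 3) * chebCoeff N (n + m + 1) (t + 1) -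
        (N + 2) ^ 2 * (N + 1 - m) * chebCoeff (N + 1) (n + m + 1) (t + 1)) := by
  have hA := invFac_sub_one (t + 1)
  have hB := invFac_sub_one (n + m + 1 - t)
  have hC := invFac_sub_one (N + 1 - t)
  have hD := invFac_sub_one (N - (n + m) + t + 1)
  simp only [chebCoeff]
  rw [show t + 1 - 1 = t by ring] at hA
  rw [show (n + m + 1 - t) - 1 = n + m - t by ring] at hB
  rw [show (N : ℤ) + 1 - t - 1 = N - t by ring] at hC
  rw [show (N : ℤ) - (n + m) + t + 1 - 1 = N - (n + m) + t by ring] at hD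
  rw [show n + m - 1 + 1 - t = n + m - t by ring,
    show (N : ℤ) - (n + m - 1) + t = N - (n + m) + t + 1 by ring,
    show n + m + 1 - (t + 1) = n + m - t by ring,
    show (N : ℤ) + 1 - (t + 1) = N - t by ring,
    show (N : ℤ) - (n + m) + (t + 1) = N - (n + m) + t + 1 by ring,
    show n + m + 1 + 1 - (t + 1) = n + m + 1 - t by ring,
    show (N : ℤ) - (n + m + 1) + (t + 1) = N - (n + m) + t by ring]
  push_cast
  rw [show (N : ℤ) + 1 + 1 - (t + 1) = N + 1 - t by ring,
    show (N : ℤ) + 1 - (n + m + 1) + (t + 1) = N - (n + m) + t + 1 by ring]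
  rw [hA, hB, hC, hD]
  push_cast
  ring

lemma chebCoeff_rec_zero (N : ℕ) (n m : ℤ) :
    (n + 1) * chebCoeff N (n + m) 0 + (N + n + 3) * chebCoeff N (n + m + 1) 0 -
        (N + 2) ^ 2 * (N + 1 - m) * chebCoeff (N + 1) (n + m + 1) 0 = 0 := by
  have h := chebCoeff_rec N n m (-1)
  have h0 : ∀ r, chebCoeff N r (-1) = 0 := fun r => by
    rw [chebCoeff, invFac_of_neg (z := -1) (by omega)]
    ring
  rw [h0, h0] at h
  simp only [neg_add_cancel] at h
  linear_combination h

lemma chebCoeff_rec_top (N n m : ℕ) :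
    (n + 1) * chebCoeff N (n + m) m - (N - n + 1) * chebCoeff N (n + m - 1) m = 0 := by
  have hA := invFac_sub_one (n + 1)
  have hD := invFac_sub_one (N - n + 1)
  simp only [chebCoeff]
  rw [show (n : ℤ) + 1 - 1 = n by ring] at hA
  rw [show (N : ℤ) - n + 1 - 1 = N - n by ring] at hD
  rw [show (n : ℤ) + m + 1 - m = n + 1 by ring, show (n : ℤ) + m - 1 + 1 - m = n by ring,
    show (N : ℤ) - (n + m) + m = N - n by ring,
    show (N : ℤ) - (n + m - 1) + m = N - n + 1 by ring, hA, hD]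
  push_cast
  ring

lemma chebSum_rec (N n m : ℕ) :
    C (2 * (n + 1) : ℂ) * X * chebSum N (n + m) m =
      -(C (N + n + 3 : ℂ) * chebSum N (n + m + 1) m) +
        C ((N + 2) ^ 2 * (N + 1 - m) : ℂ) * chebSum (N + 1) (n + m + 1) m +
        C (N - n + 1 : ℂ) * chebSum N (n + m - 1) m := by
  let f : ℤ → ℂ := fun t =>
    (n + 1) * chebCoeff N (n + m) t - (N - n + 1) * chebCoeff N (n + m - 1) t
  let g : ℤ → ℂ := fun t => (n + 1) * chebCoeff N (n + m) t +
    (N + n + 3) * chebCoeff N (n + m + 1) t -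
    (N + 2) ^ 2 * (N + 1 - m) * chebCoeff (N + 1) (n + m + 1) t
  let V : ℤ → ℂ[X] := fun t => U ℂ ((n : ℤ) + m + 1 - 2 * t)
  -- After `2x U_s = U_{s+1} + U_{s-1}`, each summand is `f t` times one Chebyshev polynomial plus
  -- `g t` times its neighbour. The lower end vanishes since `g 0 = 0`, and the upper end since `g
  -- (m + 1) = 0`.
  have key : ∀ M : ℕ, ∑ t ∈ Finset.range M, (C (f t) * V (t + 1) + C (g t) * V t) =
      -(C (g M) * V M) := by
    intro M
    induction M with
    | zero =>
      have : g 0 = 0 := by simpa [g] using chebCoeff_rec_zero N n m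
      simp [this]
    | succ M ih =>
      have : f M = - g (M + 1) := by simpa [f, g] using chebCoeff_rec N n m M
      rw [Finset.sum_range_succ, ih, this]
      push_cast
      simp
  have key' := key (m + 1)
  have htop : g (m + 1) = 0 := by
    have h1 : f m = - g (m + 1) := by simpa [f, g] using chebCoeff_rec N n m m
    have h2 : f m = 0 := chebCoeff_rec_top N n m
    rw [h2] at h1
    simpa using h1
  push_cast at key'
  rw [htop] at key'
  rw [← sub_eq_zero]
  refine Eq.trans ?_ (key'.trans (by simp))
  simp only [chebSum, Finset.mul_sum, ← Finset.sum_neg_distrib, ← Finset.sum_add_distrib,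
    ← Finset.sum_sub_distrib]
  refine Finset.sum_congr rfl fun t _ => ?_
  have hU := U_add_one ℂ ((n : ℤ) + m - 2 * t)
  simp only [f, g, V]
  rw [show (n : ℤ) + m + 1 - 2 * (t + 1) = n + m - 1 - 2 * t by ring]
  rw [show (n : ℤ) + m - 2 * t - 1 = n + m - 1 - 2 * t by ring,
    show (n : ℤ) + m - 2 * t + 1 = n + m + 1 - 2 * t by ring] at hU
  have h2 : (C 2 : ℂ[X]) = 2 := rfl
  simp only [C_sub, C_add, C_mul, h2]
  linear_combination (-(C (n : ℂ) + C 1) * C (chebCoeff N (n + m) t)) * hU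

/-- The entries of the weight, up to the factors `√(1-x²)` and `N!²`. -/
def chebEntry (N n m : ℕ) : ℂ[X] :=
  C (((N + 1)! : ℂ) ^ 2 * (N - m)! * (N - n)! * m ! * n !) * chebSum N (n + m) m

lemma chebEntry_comm (N n m : ℕ) : chebEntry N n m = chebEntry N m n := by
  rw [chebEntry, chebEntry, chebSum_comm, add_comm (n : ℤ)]
  congr 2
  ring

/-- The recurrence of `ldu_rec` for the other form. At the edges `n = 0` and `n = N`, where the
prefactor of a neighbouring entry is zero, the matching truncated sum also vanishes by
`chebSum_sub_one` and `chebSum_eq_zero`. -/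
lemma chebEntry_rec {N n m : ℕ} (hn : n ≤ N) (hm : m ≤ N) :
    chebEntry (N + 1) (n + 1) m = C (2 * (n + 1) ^ 2 : ℂ) * X * chebEntry N n m -
      C ((n : ℂ) * (n + 1)) * chebEntry N (n - 1) m -
      C ((n + 1 : ℂ) * (n + 2) - (N + 1) * (N + 2)) * chebEntry N (n + 1) m := by
  have h := chebSum_rec N n m
  set K : ℂ := ((N + 1)! : ℂ) ^ 2 * (N - m)! * m ! * (N - n)! * (n + 1)! with hK
  have e1 : chebEntry (N + 1) (n + 1) m =
      C K * (C ((N + 2) ^ 2 * (N + 1 - m) : ℂ) * chebSum (N + 1) (n + m + 1) m) := by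
    rw [chebEntry, ← mul_assoc, ← C_mul]
    congr 2
    · rw [hK, Nat.add_sub_add_right, Nat.factorial_succ (N + 1),
        show N + 1 - m = N - m + 1 by omega, Nat.factorial_succ (N - m)]
      push_cast [hm]
      ring
    · push_cast; ring
  have e2 : C (2 * (n + 1) ^ 2 : ℂ) * X * chebEntry N n m =
      C K * (C (2 * (n + 1) : ℂ) * X * chebSum N (n + m) m) := by
    have : (2 * (n + 1) ^ 2 : ℂ) * (((N + 1)! : ℂ) ^ 2 * (N - m)! * (N - n)! * m ! * n !) =
        K * (2 * (n + 1)) := by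
      rw [hK, Nat.factorial_succ n]
      push_cast
      ring
    rw [chebEntry]
    have := congr_arg C this
    rw [C_mul, C_mul (a := K)] at this
    linear_combination X * chebSum N (n + m) m * this
  have e3 : C ((n : ℂ) * (n + 1)) * chebEntry N (n - 1) m =
      C K * (C (N - n + 1 : ℂ) * chebSum N (n + m - 1) m) := by
    rcases n with _ | n
    · simp [chebSum_sub_one]
    · rw [chebEntry, ← mul_assoc, ← mul_assoc, ← C_mul, ← C_mul]
      congr 2
      · rw [hK, Nat.factorial_succ (n + 1), Nat.factorial_succ n, Nat.add_sub_cancel,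
          show N - n = N - (n + 1) + 1 by omega, Nat.factorial_succ (N - (n + 1))]
        push_cast [hn]
        ring
      · push_cast; ring
  have e4 : C ((n + 1 : ℂ) * (n + 2) - (N + 1) * (N + 2)) * chebEntry N (n + 1) m =
      -(C K * (C (N + n + 3 : ℂ) * chebSum N (n + m + 1) m)) := by
    rcases hn.eq_or_lt with rfl | hn
    · have := chebSum_eq_zero n m
      rw [show (n : ℤ) + 1 + m = n + m + 1 by ring] at this
      simp [this]
    · rw [chebEntry, ← mul_assoc, ← mul_assoc, ← C_mul, ← C_mul, ← neg_mul, ← C_neg]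
      congr 2
      · rw [hK, show N - n = N - (n + 1) + 1 by omega, Nat.factorial_succ (N - (n + 1))]
        push_cast [show n + 1 ≤ N from hn]
        ring
      · push_cast; ring
  rw [e1, e2, e3, e4]
  linear_combination -(C K) * h

lemma chebEntry_self (N : ℕ) : chebEntry N N N = C ((N ! : ℂ) * (N + 1)!) := by
  rw [chebEntry, chebSum, Finset.sum_range_succ, Finset.sum_eq_zero, zero_add]
  · rw [show (N : ℤ) + N - 2 * N = 0 by ring, U_zero, mul_one, ← C_mul]
    congr 1
    rw [chebCoeff, show (N : ℤ) + N + 1 - N = (N + 1 : ℕ) by push_cast; ring,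
      show (N : ℤ) + 1 - N = (1 : ℕ) by push_cast; ring,
      show (N : ℤ) - (N + N) + N = (0 : ℕ) by push_cast; ring]
    simp only [invFac_natCast]
    have := factorial_ne_zero' N
    have := factorial_ne_zero' (N + 1)
    simp
    field_simp
  · intro t ht
    have : t < N := by simpa using ht
    rw [chebCoeff, invFac_of_neg (z := (N : ℤ) - (N + N) + t) (by omega)]
    simp

/-- The common recurrence reaches every entry with one positive index whose partner is at most `N`.
Symmetry supplies the transposed ones, leaving the corners `(0,0)` and `(N+1,N+1)`. -/
theorem ldu_eq_chebEntry {N n m : ℕ} (hn : n ≤ N) (hm : m ≤ N) :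
    ldu N n m = chebEntry N n m := by
  induction N generalizing n m with
  | zero =>
    obtain rfl : n = 0 := by omega
    obtain rfl : m = 0 := by omega
    rw [ldu_self, chebEntry_self]
  | succ N ih =>
    have main : ∀ n m, n ≤ N → m ≤ N → ldu (N + 1) (n + 1) m = chebEntry (N + 1) (n + 1) m := by
      intro n m hn hm
      rw [ldu_rec n hm, chebEntry_rec hn hm, ih hn hm, ih (by omega : n - 1 ≤ N) hm]
      -- For `n = N` the entry in row `N + 1` escapes the induction hypothesis, but its coefficient
      -- is zero.
      rcases hn.eq_or_lt with rfl | hn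
      · simp
      · rw [ih hn hm]
    rcases n with _ | n
    · rcases m with _ | m
      · simp only [ldu, chebEntry, chebSum]
        rw [Finset.sum_eq_single 0]
        · rw [Finset.sum_range_one]
          have h1 : invFac 0 = 1 := by simpa using invFac_natCast 0
          have h2 : invFac 1 = 1 := by simpa using invFac_natCast 1
          have h3 := invFac_natCast (N + 1)
          have h4 := invFac_natCast (N + 2)
          push_cast at h3 h4
          have e1 : ell 0 0 = 1 := by simp [ell, dU]
          have := factorial_ne_zero' (N + 1)
          have := factorial_ne_zero' (N + 2)
          rw [e1]
          simp [chebCoeff, h1, h2, h3]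
          rw [show (N : ℤ) + 1 + 1 = N + 2 by ring, h4]
          simp only [← C_eq_natCast, ← C_mul, ← C_pow]
          congr 1
          rw [show N + 1 + 1 = N + 2 by ring]
          field_simp
        · intro j _ hj
          rw [ell_eq_zero (by omega)]
          simp
        · simp
      · rw [ldu_comm, chebEntry_comm]
        exact main m 0 (by omega) (by omega)
    · rcases hm.eq_or_lt with rfl | hm
      · rcases hn.eq_or_lt with hn | hn
        · obtain rfl : n = N := by omega
          rw [ldu_self, chebEntry_self]
        · rw [ldu_comm, chebEntry_comm]
          exact main N (n + 1) le_rfl (by omega)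
      · exact main n m (by omega) (by omega)

/-! ### The matrix weight, its inner product and its moments. -/

section

lemma poch_zero (a : ℂ) : poch a 0 = 1 := by simp [poch]

lemma poch_succ (a : ℂ) (n : ℕ) : poch a (n + 1) = poch a n * (a + n) := by
  simp [poch, ascPochhammer_succ_eval]

lemma poch_succ_left (a : ℂ) (n : ℕ) : poch a (n + 1) = a * poch (a + 1) n := by
  simp [poch, ascPochhammer_succ_left]

lemma poch_natCast_add_one (M s : ℕ) : poch (M + 1) s = ((M + s)! : ℂ) / M ! := by
  have := factorial_ne_zero' M
  induction s with
  | zero => simp [poch_zero, this]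
  | succ s ih =>
    rw [poch_succ, ih, ← add_assoc, Nat.factorial_succ]
    push_cast
    field_simp
    ring

lemma neg_one_pow_mul_poch_neg (M s : ℕ) :
    (-1) ^ s * poch (-M) s = (M ! : ℂ) * invFac (M - s) := by
  induction s with
  | zero =>
    have := factorial_ne_zero' M
    simp [poch_zero, invFac_natCast, this]
  | succ s ih =>
    have h := invFac_sub_one (M - s)
    push_cast at h ⊢
    rw [poch_succ, ← sub_sub, h]
    linear_combination (M - s : ℂ) * ih

lemma ofReal_eval_ascPochhammer (x : ℝ) (s : ℕ) :
    (((ascPochhammer ℝ s).eval x : ℝ) : ℂ) = poch x s := by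
  induction s with
  | zero => simp [poch_zero]
  | succ s ih => rw [poch_succ, ← ih, ascPochhammer_succ_eval]; push_cast; ring

lemma ofReal_weightCoeff {N t m n : ℕ} (ht : t ≤ m) (hm : m ≤ n) (hn : n ≤ N) :
    (weightCoeff N t m n : ℂ) = ((N ! : ℂ) ^ 2)⁻¹ *
      (((N + 1)! : ℂ) ^ 2 * (N - m)! * (N - n)! * m ! * n ! * chebCoeff N (n + m) t) := by
  have h1 := neg_one_pow_mul_poch_neg (N - n) (m - t)
  have h2 := poch_natCast_add_one (n + 1) (m - t)
  have h3 := poch_natCast_add_one (N + 1 - t) t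
  rw [show N + 1 - t + t = N + 1 by omega] at h3
  rw [weightCoeff, chebCoeff]
  push_cast
  simp only [ofReal_eval_ascPochhammer]
  push_cast [hn, show t ≤ N + 1 by omega] at h1 h2 h3 ⊢
  rw [neg_sub] at h1
  rw [show (n : ℂ) + 1 + 1 = n + 2 by ring] at h2
  rw [show (N : ℂ) + 1 - t + 1 = N + 2 - t by ring] at h3
  rw [show (N : ℤ) - n - (m - t : ℕ) = N - (n + m) + t by omega] at h1
  rw [h2, h3, invFac_natCast, show (n : ℤ) + m + 1 - t = (n + 1 + (m - t) : ℕ) by omega,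
    show (N : ℤ) + 1 - t = (N + 1 - t : ℕ) by omega, invFac_natCast, invFac_natCast]
  have f1 := factorial_ne_zero' N
  have f2 := factorial_ne_zero' t
  have f3 := factorial_ne_zero' (n + 1 + (m - t))
  have f4 := factorial_ne_zero' (N + 1 - t)
  have f5 := factorial_ne_zero' (n + 1)
  have f6 : (n : ℂ) + 1 ≠ 0 := by exact_mod_cast n.succ_ne_zero
  have e : ∀ a b c d e : ℂ, a * b * (-1) ^ (m - t) * (c / d) * e =
      a * b * (((-1) ^ (m - t) * c) / d) * e := fun a b c d e => by ring
  rw [e, h1, Nat.factorial_succ N, Nat.factorial_succ n]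
  push_cast
  field_simp

variable {N : ℕ}

/-- The polynomial part of the weight. -/
def polyW (N : ℕ) : Matrix (Fin (N + 1)) (Fin (N + 1)) ℂ[X] :=
  Matrix.of fun n m => C ((N ! : ℂ) ^ 2)⁻¹ * ldu N n m

lemma polyW_transpose : (polyW N)ᵀ = polyW N := by
  ext1 i j
  simp [polyW, ldu_comm N i j]

lemma eval_U_ofReal (r : ℤ) (x : ℝ) : (U ℂ r).eval (x : ℂ) = ((U ℝ r).eval x : ℝ) := by
  have := Polynomial.Chebyshev.map_U (Complex.ofRealHom) r
  rw [← this, eval_map, ← Complex.ofRealHom_eq_coe, ← Complex.ofRealHom_eq_coe, eval₂_hom]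

lemma weightEntry_eq {n m : ℕ} (hm : m ≤ n) (hn : n ≤ N) (x : ℝ) :
    (weightEntry N n m x : ℂ) =
      (√(1 - x ^ 2) : ℂ) * (C ((N ! : ℂ) ^ 2)⁻¹ * ldu N n m).eval (x : ℂ) := by
  rw [ldu_eq_chebEntry hn (hm.trans hn), weightEntry, chebEntry, chebSum]
  push_cast
  congr 1
  simp only [eval_mul, eval_C, eval_finsetSum, Finset.mul_sum]
  refine Finset.sum_congr rfl fun t ht => ?_
  rw [ofReal_weightCoeff (by simpa [Nat.lt_succ_iff] using ht) hm hn, eval_U_ofReal]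
  ring

lemma W_eq (x : ℝ) : W N x = (√(1 - x ^ 2) : ℂ) • evalMat (polyW N) x := by
  ext n m
  have hn := Nat.lt_succ_iff.1 n.2
  have hm := Nat.lt_succ_iff.1 m.2
  simp only [W, Matrix.of_apply, Matrix.smul_apply, evalMat, Matrix.map_apply, polyW, smul_eq_mul]
  split_ifs with h
  · exact weightEntry_eq h hn x
  · rw [ldu_comm]
    exact weightEntry_eq (not_le.1 h).le hm x

/-- Entrywise complex conjugation of the coefficients. -/
def conjMat (Q : Matrix (Fin (N + 1)) (Fin (N + 1)) ℂ[X]) :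
    Matrix (Fin (N + 1)) (Fin (N + 1)) ℂ[X] :=
  Q.map (mapRingHom (starRingEnd ℂ))

lemma evalMat_mul (P Q : Matrix (Fin (N + 1)) (Fin (N + 1)) ℂ[X]) (x : ℂ) :
    evalMat (P * Q) x = evalMat P x * evalMat Q x :=
  Matrix.map_mul (f := evalRingHom x)

lemma evalMat_conjTranspose (Q : Matrix (Fin (N + 1)) (Fin (N + 1)) ℂ[X]) (x : ℝ) :
    (evalMat Q x)ᴴ = evalMat (conjMat Q)ᵀ x := by
  ext i j
  simp only [evalMat, Matrix.conjTranspose_apply, Matrix.map_apply, Matrix.transpose_apply,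
    conjMat, coe_mapRingHom]
  have := eval₂_hom (p := Q j i) (starRingEnd ℂ) (x : ℂ)
  rw [Complex.conj_ofReal] at this
  rw [eval_map, this]
  rfl

lemma innerW_apply (P Q : Matrix (Fin (N + 1)) (Fin (N + 1)) ℂ[X]) (i j : Fin (N + 1)) :
    innerW P Q i j = semicircle ((P * polyW N * (conjMat Q)ᵀ) i j) := by
  rw [innerW, Matrix.of_apply, semicircle_apply]
  congr 1 with x
  rw [W_eq, evalMat_conjTranspose, Matrix.mul_smul, Matrix.smul_mul, ← evalMat_mul, ← evalMat_mul]
  rfl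

/-- The moment matrix `∫ P(x) W(x) dx`. -/
def moment (P : Matrix (Fin (N + 1)) (Fin (N + 1)) ℂ[X]) : Matrix (Fin (N + 1)) (Fin (N + 1)) ℂ :=
  (P * polyW N).map semicircle

lemma moment_add (P Q : Matrix (Fin (N + 1)) (Fin (N + 1)) ℂ[X]) :
    moment (P + Q) = moment P + moment Q := by
  ext; simp [moment, add_mul]

lemma moment_C_mul (A : Matrix (Fin (N + 1)) (Fin (N + 1)) ℂ)
    (P : Matrix (Fin (N + 1)) (Fin (N + 1)) ℂ[X]) : moment (A.map C * P) = A * moment P := by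
  ext i j
  simp [moment, Matrix.mul_assoc, Matrix.mul_apply (M := A), Matrix.mul_apply (M := A.map C),
    semicircle_C_mul]

/-- Expanding `Q` in powers of `x` reduces orthogonality to the moments of `x^m P`. -/
lemma innerW_eq_sum (P Q : Matrix (Fin (N + 1)) (Fin (N + 1)) ℂ[X]) {d : ℕ}
    (hQ : ∀ i j, (Q i j).natDegree ≤ d) :
    innerW P Q = ∑ m ∈ Finset.range (d + 1),
      moment ((X : ℂ[X]) ^ m • P) * (Q.map fun p => p.coeff m)ᴴ := by
  ext i j
  rw [innerW_apply, Matrix.sum_apply, Matrix.mul_apply, map_sum]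
  simp only [Matrix.mul_apply (M := moment _)]
  rw [Finset.sum_comm]
  refine Finset.sum_congr rfl fun a _ => ?_
  have hq : conjMat Q j a = ∑ m ∈ Finset.range (d + 1), C (star ((Q j a).coeff m)) * X ^ m := by
    rw [conjMat, Matrix.map_apply, coe_mapRingHom]
    conv_lhs => rw [(Q j a).as_sum_range' (d + 1) (Nat.lt_succ_of_le (hQ j a))]
    rw [Polynomial.map_sum]
    simp [← C_mul_X_pow_eq_monomial]
  rw [Matrix.transpose_apply, hq, Finset.mul_sum, map_sum]
  refine Finset.sum_congr rfl fun m _ => ?_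
  rw [mul_left_comm, semicircle_C_mul, mul_comm (star _)]
  simp [moment, mul_comm]

lemma conjMat_conjMat (Q : Matrix (Fin (N + 1)) (Fin (N + 1)) ℂ[X]) :
    conjMat (conjMat Q) = Q := by
  ext1 i j
  simp only [conjMat, Matrix.map_apply, coe_mapRingHom, Polynomial.map_map]
  rw [show (starRingEnd ℂ).comp (starRingEnd ℂ) = RingHom.id ℂ by ext; simp, Polynomial.map_id]

lemma conjMat_polyW : conjMat (polyW N) = polyW N := by
  have hell : ∀ n j, (ell n j).map (starRingEnd ℂ) = ell n j := fun n j => by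
    simp [ell, dU, ← Polynomial.iterate_derivative_map, Polynomial.Chebyshev.map_U]
  ext1 i j
  simp [conjMat, polyW, ldu, Polynomial.map_sum, hell, Complex.conj_ofNat]

lemma star_semicircle (f : ℂ[X]) : star (semicircle f) = semicircle (f.map (starRingEnd ℂ)) := by
  rw [semicircle_apply, semicircle_apply]
  have h := intervalIntegral.intervalIntegral_eq_integral_uIoc
    (fun x : ℝ => (√(1 - x ^ 2) : ℂ) * f.eval (x : ℂ)) (-1) 1 MeasureTheory.volume
  have h' := intervalIntegral.intervalIntegral_eq_integral_uIoc
    (fun x : ℝ => (√(1 - x ^ 2) : ℂ) * (f.map (starRingEnd ℂ)).eval (x : ℂ)) (-1) 1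
    MeasureTheory.volume
  rw [h, h', if_pos (by norm_num), one_smul, one_smul, ← starRingEnd_apply, ← integral_conj]
  congr 1 with x
  have := eval₂_hom (p := f) (starRingEnd ℂ) (x : ℂ)
  rw [Complex.conj_ofReal] at this
  rw [eval_map, this]
  simp

lemma innerW_conjTranspose (P Q : Matrix (Fin (N + 1)) (Fin (N + 1)) ℂ[X]) :
    (innerW P Q)ᴴ = innerW Q P := by
  ext i j
  rw [Matrix.conjTranspose_apply, innerW_apply, innerW_apply, star_semicircle]
  congr 1
  have h : conjMat (P * polyW N * (conjMat Q)ᵀ) = conjMat P * polyW N * Qᵀ := by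
    have hm : ∀ A B : Matrix (Fin (N + 1)) (Fin (N + 1)) ℂ[X],
        conjMat (A * B) = conjMat A * conjMat B := fun A B => Matrix.map_mul
    have ht : conjMat (conjMat Q)ᵀ = (conjMat (conjMat Q))ᵀ := rfl
    rw [hm, hm, conjMat_polyW, ht, conjMat_conjMat]
  have h2 := congr_arg (fun A => Aᵀ i j) h
  simp only [Matrix.transpose_mul, Matrix.transpose_transpose, polyW_transpose] at h2
  exact h2.trans (by rw [Matrix.mul_assoc])

end

/-! ### Racah sums and their contiguous relations, term by term. -/

lemma poch_neg_eq_zero {j i : ℕ} (h : j < i) : poch (-j) i = 0 := by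
  have h1 := neg_one_pow_mul_poch_neg j i
  rw [invFac_of_neg (by omega), mul_zero] at h1
  exact (mul_eq_zero.1 h1).resolve_left (by simp)

/-- The polynomials `(-j)_i (j+1)_i` in `j (j+1)`. -/
def dualPoch (j i : ℕ) : ℂ := poch (-j) i * poch (j + 1) i

lemma dualPoch_eq_zero {j i : ℕ} (h : j < i) : dualPoch j i = 0 := by
  rw [dualPoch, poch_neg_eq_zero h, zero_mul]

/-- These products are a Newton basis in the variable `j(j+1)`, so multiplication by `j(j+1)` acts
on sums over `i` as a diagonal term plus a shift. -/
lemma dualPoch_succ (j i : ℕ) :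
    dualPoch j (i + 1) = (i * (i + 1) - j * (j + 1)) * dualPoch j i := by
  rw [dualPoch, dualPoch, poch_succ, poch_succ]
  ring

lemma dualPoch_succ_left (j i : ℕ) :
    dualPoch (j + 1) i * (i - j - 1) + dualPoch j i * (i + j + 1) = 0 := by
  have h1 := poch_succ (-(j + 1)) i
  have h2 := poch_succ_left (-(j + 1)) i
  have h3 := poch_succ (j + 1) i
  have h4 := poch_succ_left (j + 1) i
  have hj : (j : ℂ) + 1 ≠ 0 := by exact_mod_cast j.succ_ne_zero
  rw [show -(j + 1 : ℂ) + 1 = -j by ring] at h2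
  simp only [dualPoch]
  push_cast
  apply mul_left_cancel₀ hj
  linear_combination poch (j + 1 + 1) i * (j + 1) * (h2 - h1) +
    (j + 1) * poch (-j) i * (h4 - h3)

/-- Equivalent to `₂F₁(-j, j+1; 1; 1)` changing sign when `j` grows by one. The partial sums have a
closed form, which vanishes once the range exhausts the terms. -/
lemma sum_dualPoch_add (j : ℕ) :
    ∑ i ∈ Finset.range (j + 2), (dualPoch (j + 1) i + dualPoch j i) / (i ! : ℂ) ^ 2 = 0 := by
  have key : ∀ M : ℕ, ∑ i ∈ Finset.range M, (dualPoch (j + 1) i + dualPoch j i) / (i ! : ℂ) ^ 2 =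
      -2 / (j + 1) * M ^ 2 * (dualPoch (j + 1) M / (M ! : ℂ) ^ 2) / (j + 1 + M) := by
    intro M
    induction M with
    | zero => simp
    | succ M ih =>
      have h1 := dualPoch_succ (j + 1) M
      have h2 := dualPoch_succ_left j M
      have hj : (j : ℂ) + 1 ≠ 0 := by exact_mod_cast j.succ_ne_zero
      have hM : (M : ℂ) + 1 ≠ 0 := by exact_mod_cast M.succ_ne_zero
      have hjM : (j : ℂ) + 1 + M ≠ 0 := by
        rw [add_right_comm]; exact_mod_cast (j + M).succ_ne_zero
      have hjM' : (j : ℂ) + 1 + (M + 1) ≠ 0 := by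
        rw [show (j : ℂ) + 1 + (M + 1) = (j + M + 1 : ℕ) + 1 by push_cast; ring]
        exact_mod_cast (j + M + 1).succ_ne_zero
      have hf := factorial_ne_zero' M
      have h3 : dualPoch j M = dualPoch (j + 1) M * (j + 1 - M) / (j + 1 + M) := by
        rw [eq_div_iff hjM]
        linear_combination h2
      rw [Finset.sum_range_succ, ih, Nat.factorial_succ, h1, h3]
      push_cast
      field_simp
      ring
  rw [key, dualPoch_eq_zero (by omega)]
  simp

/-- A balanced `₃F₂(-j, j+1, -N-1; 1, -N; 1)`, of Saalschütz type. A first-order recurrence in `j`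
suffices: by `dualPoch_succ_left` the denominators `N + 1 - i` cancel, leaving `sum_dualPoch_add`.
-/
lemma sum_dualPoch_div {N j : ℕ} (hj : j ≤ N) :
    poch (-N) j / poch (N + 2) j *
      ∑ i ∈ Finset.range (j + 1), dualPoch j i * ((N + 1) / ((N + 1 - i) * (i ! : ℂ) ^ 2)) = 1 := by
  have hN : (N : ℂ) + 1 ≠ 0 := by exact_mod_cast N.succ_ne_zero
  induction j with
  | zero => simp [poch_zero, dualPoch, hN]
  | succ j ih =>
    specialize ih (by omega)
    set f : ℕ → ℂ := fun j =>
      ∑ i ∈ Finset.range (j + 1), dualPoch j i * ((N + 1) / ((N + 1 - i) * (i ! : ℂ) ^ 2)) with hf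
    have hrec : (N - j : ℂ) * f (j + 1) + (N + j + 2) * f j = 0 := by
      have e : f j = ∑ i ∈ Finset.range (j + 1 + 1),
          dualPoch j i * ((N + 1) / ((N + 1 - i) * (i ! : ℂ) ^ 2)) := by
        rw [Finset.sum_range_succ, dualPoch_eq_zero (by omega)]
        simp [hf]
      rw [e, hf, Finset.mul_sum, Finset.mul_sum, ← Finset.sum_add_distrib]
      have h := congr_arg (fun z => (N + 1 : ℂ) * z) (sum_dualPoch_add j)
      simp only [mul_zero, Finset.mul_sum] at h
      refine (Finset.sum_congr rfl fun i hi => ?_).trans h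
      have hi : i ≤ N := by
        have : i < j + 1 + 1 := Finset.mem_range.1 hi
        omega
      have h2 := dualPoch_succ_left j i
      have hi2 : (N : ℂ) + 1 - i ≠ 0 := by
        rw [sub_ne_zero]
        exact_mod_cast (show N + 1 ≠ i by omega)
      have := factorial_ne_zero' i
      field_simp
      linear_combination h2
    have h1 : (N : ℂ) + j + 2 ≠ 0 := by exact_mod_cast (N + j + 1).succ_ne_zero
    rw [poch_succ, poch_succ, mul_div_mul_comm]
    have h4 : (-(N : ℂ) + j) / (N + 2 + j) * f (j + 1) = f j := by
      rw [add_right_comm, div_mul_eq_mul_div, div_eq_iff h1]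
      linear_combination -hrec
    rw [mul_assoc, h4, ih]

/-- The summands of the dual Racah coefficients, up to `dualPoch j i`. -/
def racahTerm (N n k i : ℕ) : ℂ :=
  (n ! : ℂ) * (N + n + 1)! * k ! * (N - k)! / (2 ^ n * (N + 1)! * (n + k)! * (N - k + n)!) *
    (k ! * invFac (k - i) * (n + k - i)! / (n + k)!) *
    ((N + n + 1)! * (N - i)! / ((N + n + 1 - i)! * N ! * (i ! : ℂ) ^ 2))

/-- Coefficient of the raising part of the recurrence matrix. -/
def upCoeff (N n k : ℕ) : ℂ := (N - k) ^ 2 / (2 * (n + (N - k)) * (n + (N - k) + 1))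

/-- Coefficient of the lowering part of the recurrence matrix. -/
def downCoeff (n k : ℕ) : ℂ := k ^ 2 / (2 * (n + k) * (n + k + 1))

/-- Coefficient of `P_{n-1}` in the recurrence. -/
def prevCoeff (N n k : ℕ) : ℂ :=
  n ^ 2 * (N + n + 1) ^ 2 / (4 * (n + k) * (n + k + 1) * (n + (N - k)) * (n + (N - k) + 1))

lemma racahTerm_lower_zero {N k i : ℕ} (hi : i < k) (hk : k ≤ N) :
    (k : ℂ) / (2 * (k + 1)) * racahTerm N 0 k i = downCoeff 0 k * racahTerm N 0 (k - 1) i := by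
  obtain ⟨k, rfl⟩ : ∃ k', k = k' + 1 := ⟨k - 1, by omega⟩
  have hV := invFac_sub_one (k + 1 - i)
  have e1 : k + 1 - i = (k - i) + 1 := by omega
  have e2 : N - k = N - (k + 1) + 1 := by omega
  have hk1 : (k : ℂ) + 1 ≠ 0 := by exact_mod_cast k.succ_ne_zero
  have hk2 : (k : ℂ) + 1 + 1 ≠ 0 := by exact_mod_cast (k + 1).succ_ne_zero
  simp only [racahTerm, downCoeff, Nat.add_sub_cancel, zero_add, add_zero]
  rw [show (k : ℤ) + 1 - i - 1 = k - i by ring] at hV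
  rw [e1, e2, Nat.factorial_succ (k - i), Nat.factorial_succ k, Nat.factorial_succ (N - (k + 1))]
  push_cast [show i ≤ k by omega, hk, hV]
  have := factorial_ne_zero' k
  have := factorial_ne_zero' N
  have := factorial_ne_zero' (N + 1)
  have := factorial_ne_zero' (N + 1 - i)
  have := factorial_ne_zero' (N - (k + 1))
  have := factorial_ne_zero' i
  have : (N : ℂ) - (k + 1) + 1 ≠ 0 := by
    simpa [hk] using Nat.cast_add_one_ne_zero (R := ℂ) (N - (k + 1))
  field_simp
  ring

lemma racahTerm_lower_succ {N n k i : ℕ} (hi : i ≤ n + k) (hk : k ≤ N) :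
    ((n + 1 + k : ℕ) : ℂ) / (2 * ((n + 1 + k : ℕ) + 1)) * racahTerm N (n + 1) k i =
      downCoeff (n + 1) k * racahTerm N (n + 1) (k - 1) i +
        prevCoeff N (n + 1) k * racahTerm N n k i := by
  by_cases hik : k < i
  · have h1 : invFac (k - i) = 0 := invFac_of_neg (by omega)
    have h2 : invFac ((k - 1 : ℕ) - i) = 0 := invFac_of_neg (by omega)
    simp [racahTerm, h1, h2]
  have hN2 : (N : ℂ) + n + 2 ≠ 0 := by exact_mod_cast (N + n + 1).succ_ne_zero
  have f1 := factorial_ne_zero' (n + k)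
  have f2 := factorial_ne_zero' N
  have f3 := factorial_ne_zero' (N + 1)
  have f4 := factorial_ne_zero' (N + n + 1 - i)
  have f5 := factorial_ne_zero' (N - k + n)
  have f6 := factorial_ne_zero' i
  have g1 : (n : ℂ) + k + 1 ≠ 0 := by exact_mod_cast (n + k).succ_ne_zero
  have g2 : (n : ℂ) + k + 2 ≠ 0 := by exact_mod_cast (n + k + 1).succ_ne_zero
  have g3 : (N : ℂ) - k + n + 1 ≠ 0 := by
    simpa [hk] using Nat.cast_add_one_ne_zero (R := ℂ) (N - k + n)
  have g4 : (N : ℂ) - k + n + 2 ≠ 0 := by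
    have := Nat.cast_add_one_ne_zero (R := ℂ) (N - k + n + 1)
    push_cast [hk] at this
    rwa [add_assoc _ (1 : ℂ), one_add_one_eq_two] at this
  have g5 : (N : ℂ) + n + 2 - i ≠ 0 := by
    have := Nat.cast_add_one_ne_zero (R := ℂ) (N + n + 1 - i)
    push_cast [show i ≤ N + n + 1 by omega] at this
    convert this using 1
    ring
  have g6 : (n : ℂ) + k + 1 - i ≠ 0 := by
    have := Nat.cast_add_one_ne_zero (R := ℂ) (n + k - i)
    push_cast [hi] at this
    convert this using 1
    ring
  have t1 : racahTerm N (n + 1) k i = racahTerm N n k i *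
      ((n + 1) * (N + n + 2) ^ 2 * (n + k + 1 - i) /
        (2 * (n + k + 1) ^ 2 * (N - k + n + 1) * (N + n + 2 - i))) := by
    simp only [racahTerm]
    rw [show n + 1 + k - i = (n + k - i) + 1 by omega, show n + 1 + k = n + k + 1 by ring,
      show N + (n + 1) + 1 - i = (N + n + 1 - i) + 1 by omega,
      show N + (n + 1) + 1 = (N + n + 1) + 1 by ring, ← add_assoc (N - k)]
    simp only [Nat.factorial_succ n, Nat.factorial_succ (n + k), Nat.factorial_succ (n + k - i),
      Nat.factorial_succ (N + n + 1 - i), Nat.factorial_succ (N + n + 1),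
      Nat.factorial_succ (N - k + n)]
    push_cast [hk, hi, show i ≤ N + n + 1 by omega]
    rw [show (N : ℂ) + n + 1 - i + 1 = N + n + 2 - i by ring,
      show (N : ℂ) + n + 1 + 1 = N + n + 2 by ring]
    field_simp
    ring
  have t2 : (k : ℂ) * racahTerm N (n + 1) (k - 1) i = racahTerm N n k i *
      ((n + 1) * (N + n + 2) ^ 2 * (N - k + 1) * (k - i) /
        (2 * k * (N - k + n + 1) * (N - k + n + 2) * (N + n + 2 - i))) := by
    rcases k with _ | k
    · simp
    have hV := invFac_sub_one (k + 1 - i)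
    rw [show (k : ℤ) + 1 - i - 1 = k - i by ring] at hV
    have hk1 : (k : ℂ) + 1 ≠ 0 := by exact_mod_cast k.succ_ne_zero
    have f7 := factorial_ne_zero' k
    simp only [racahTerm, Nat.add_sub_cancel]
    rw [show n + 1 + k = n + (k + 1) by ring,
      show N + (n + 1) + 1 - i = (N + n + 1 - i) + 1 by omega,
      show N + (n + 1) + 1 = (N + n + 1) + 1 by ring,
      show N - k + (n + 1) = N - (k + 1) + n + 1 + 1 by omega,
      show N - k = N - (k + 1) + 1 by omega]
    simp only [Nat.factorial_succ n, Nat.factorial_succ k, Nat.factorial_succ (N + n + 1 - i),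
      Nat.factorial_succ (N + n + 1), Nat.factorial_succ (N - (k + 1) + n + 1),
      Nat.factorial_succ (N - (k + 1) + n), Nat.factorial_succ (N - (k + 1))]
    push_cast [hk, show i ≤ N + n + 1 by omega, hV] at g3 g4 ⊢
    rw [show (N : ℂ) + n + 1 - i + 1 = N + n + 2 - i by ring,
      show (N : ℂ) + n + 1 + 1 = N + n + 2 by ring,
      show (N : ℂ) - (k + 1) + n + 1 + 1 = N - (k + 1) + n + 2 by ring]
    field_simp
    ring
  have e : downCoeff (n + 1) k * racahTerm N (n + 1) (k - 1) i =
      k / (2 * (n + k + 1) * (n + k + 2)) * (k * racahTerm N (n + 1) (k - 1) i) := by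
    rw [downCoeff]
    push_cast
    rw [show (n : ℂ) + 1 + k = n + k + 1 by ring, show (n : ℂ) + k + 1 + 1 = n + k + 2 by ring]
    ring
  rw [e, t2, t1, prevCoeff]
  push_cast
  rw [show (n : ℂ) + 1 + k = n + k + 1 by ring, show (n : ℂ) + k + 1 + 1 = n + k + 2 by ring,
    show (n : ℂ) + 1 + (N - k) = N - k + n + 1 by ring,
    show (N : ℂ) - k + n + 1 + 1 = N - k + n + 2 by ring,
    show (N : ℂ) + (n + 1) + 1 = N + n + 2 by ring]
  -- The right side of `t2` divides by `k`; at `k = 0` it is zero by convention, and `i ≤ k` forces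
  -- `i = 0`.
  rcases Nat.eq_zero_or_pos k with rfl | hk0
  · obtain rfl : i = 0 := by omega
    push_cast at *
    simp only [sub_zero, add_zero] at *
    field_simp
    ring
  · have hk1 : (k : ℂ) ≠ 0 := by exact_mod_cast hk0.ne'
    field_simp
    ring

/-- Unlike the lowering relation, this one carries the factor `j(j+1)` after summation; the term
with index `i - 1` is its shift part. -/
lemma racahTerm_raise {N n k i : ℕ} (hi : i ≤ N) (hk : k ≤ N) :
    ((n + k + 1 : ℂ) * (n + k + 2) - i * (i + 1)) * racahTerm N n k i +
        (if i = 0 then 0 else racahTerm N n k (i - 1)) =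
      2 * (n + k + 1) ^ 2 *
        (racahTerm N (n + 1) k i + upCoeff N n k * racahTerm N n (k + 1) i) := by
  have hN2 : (N : ℂ) + n + 2 ≠ 0 := by exact_mod_cast (N + n + 1).succ_ne_zero
  have f1 := factorial_ne_zero' (n + k)
  have f2 := factorial_ne_zero' N
  have f3 := factorial_ne_zero' (N + 1)
  have f4 := factorial_ne_zero' (N + n + 1 - i)
  have f5 := factorial_ne_zero' (N - k + n)
  have f6 := factorial_ne_zero' i
  have g1 : (n : ℂ) + k + 1 ≠ 0 := by exact_mod_cast (n + k).succ_ne_zero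
  have g3 : (N : ℂ) - k + n + 1 ≠ 0 := by
    simpa [hk] using Nat.cast_add_one_ne_zero (R := ℂ) (N - k + n)
  have g5 : (N : ℂ) + n + 2 - i ≠ 0 := by
    have := Nat.cast_add_one_ne_zero (R := ℂ) (N + n + 1 - i)
    push_cast [show i ≤ N + n + 1 by omega] at this
    convert this using 1
    ring
  have hV := invFac_sub_one (k + 1 - i)
  rw [show (k : ℤ) + 1 - i - 1 = k - i by ring] at hV
  push_cast at hV
  set V := invFac (k + 1 - i) with hVdef
  -- A common factor of all four terms, using `1/(k+1-i)!` so that it also covers `i = k + 1`.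
  -- Dividing it out leaves a rational identity.
  set Z : ℂ := (n ! : ℂ) * (N + n + 1)! * k ! * (N - k)! /
      (2 ^ n * (N + 1)! * (n + k)! * (N - k + n)!) *
    (k ! * V * (n + k + 1 - i)! / (n + k)!) *
    ((N + n + 1)! * (N - i)! / ((N + n + 1 - i)! * (N + n + 2 - i) * N ! * (i ! : ℂ) ^ 2)) with hZ
  have t1 : ((n + k + 1 : ℂ) * (n + k + 2) - i * (i + 1)) * racahTerm N n k i =
      Z * ((n + k + 2 + i) * (k + 1 - i) * (N + n + 2 - i)) := by
    have h : (n + k + 1 - i : ℂ) * (n + k - i)! * invFac (k - i) =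
        (n + k + 1 - i)! * invFac (k - i) := by
      by_cases h : i ≤ k
      · rw [show n + k + 1 - i = (n + k - i) + 1 by omega, Nat.factorial_succ]
        push_cast [show i ≤ n + k by omega]
        ring
      · rw [invFac_of_neg (by omega)]
        simp
    have e : ((n + k + 1 : ℂ) * (n + k + 2) - i * (i + 1)) =
        (n + k + 2 + i) * (n + k + 1 - i) := by ring
    rw [hV] at h
    set c : ℂ := (n ! : ℂ) * (N + n + 1)! * k ! * (N - k)! /
        (2 ^ n * (N + 1)! * (n + k)! * (N - k + n)!) * (k ! / (n + k)!) *
      ((N + n + 1)! * (N - i)! / ((N + n + 1 - i)! * N ! * (i ! : ℂ) ^ 2)) with hc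
    have hz : Z * (N + n + 2 - i) = c * V * (n + k + 1 - i)! := by
      rw [hZ, hc]
      field_simp
    have hr : racahTerm N n k i = c * (n + k - i)! * ((k + 1 - i) * V) := by
      rw [racahTerm, hc, hV]
      ring
    rw [hr, e]
    linear_combination c * (n + k + 2 + i : ℂ) * h - (n + k + 2 + i) * (k + 1 - i : ℂ) * hz
  have t2 : (if i = 0 then 0 else racahTerm N n k (i - 1)) = Z * ((N - i + 1) * i ^ 2) := by
    rcases i with _ | i
    · simp
    have hi1 : (i : ℂ) + 1 ≠ 0 := Nat.cast_add_one_ne_zero i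
    have f7 := factorial_ne_zero' i
    rw [if_neg (Nat.succ_ne_zero i), Nat.add_sub_cancel, racahTerm, hZ, hVdef,
      show (k : ℤ) + 1 - (i + 1 : ℕ) = k - i by push_cast; ring,
      show N + n + 1 - i = N + n + 1 - (i + 1) + 1 by omega,
      show n + k + 1 - (i + 1) = n + k - i by omega, show N - i = N - (i + 1) + 1 by omega,
      Nat.factorial_succ (N + n + 1 - (i + 1)), Nat.factorial_succ (N - (i + 1)),
      Nat.factorial_succ i]
    rw [show N + n + 1 - (i + 1) = N + n - i by omega] at f4 ⊢
    push_cast [hi, show i ≤ N + n by omega] at g5 ⊢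
    rw [show (N : ℂ) + n - i + 1 = N + n + 2 - (i + 1) by ring]
    field_simp
  have t3 : racahTerm N (n + 1) k i = Z * ((n + 1) * (N + n + 2) ^ 2 * (k + 1 - i) /
      (2 * (n + k + 1) ^ 2 * (N - k + n + 1))) := by
    rw [racahTerm, hZ, hV, show n + 1 + k = n + k + 1 by ring,
      show N + (n + 1) + 1 - i = (N + n + 1 - i) + 1 by omega,
      show N + (n + 1) + 1 = (N + n + 1) + 1 by ring, ← add_assoc (N - k)]
    simp only [Nat.factorial_succ n, Nat.factorial_succ (n + k),
      Nat.factorial_succ (N + n + 1 - i), Nat.factorial_succ (N + n + 1),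
      Nat.factorial_succ (N - k + n)]
    push_cast [hk, show i ≤ N + n + 1 by omega]
    rw [show (N : ℂ) + n + 1 - i + 1 = N + n + 2 - i by ring,
      show (N : ℂ) + n + 1 + 1 = N + n + 2 by ring]
    field_simp
    ring
  have t4 : upCoeff N n k * racahTerm N n (k + 1) i =
      Z * ((N - k) * (k + 1) ^ 2 * (N + n + 2 - i) / (2 * (n + k + 1) ^ 2 * (N - k + n + 1))) := by
    rcases hk.eq_or_lt with rfl | hk
    · simp [upCoeff]
    have f7 := factorial_ne_zero' (N - (k + 1) + n)
    have g4 : (N : ℂ) - k + n ≠ 0 := by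
      have := Nat.cast_add_one_ne_zero (R := ℂ) (N - (k + 1) + n)
      push_cast [show k + 1 ≤ N from hk] at this
      convert this using 1
      ring
    have g7 : (N : ℂ) - k ≠ 0 := by
      have := Nat.cast_add_one_ne_zero (R := ℂ) (N - (k + 1))
      push_cast [show k + 1 ≤ N from hk] at this
      convert this using 1
      ring
    rw [racahTerm, hZ, show ((k + 1 : ℕ) : ℤ) - i = k + 1 - i by push_cast; ring, ← hVdef,
      ← add_assoc n k 1, show N - k + n = N - (k + 1) + n + 1 by omega,
      show N - k = N - (k + 1) + 1 by omega, upCoeff]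
    simp only [Nat.factorial_succ k, Nat.factorial_succ (n + k),
      Nat.factorial_succ (N - (k + 1) + n), Nat.factorial_succ (N - (k + 1))]
    push_cast [show k + 1 ≤ N from hk]
    rw [show (N : ℂ) - (k + 1) + n + 1 = N - k + n by ring,
      show (N : ℂ) - (k + 1) + 1 = N - k by ring,
      show (n : ℂ) + (N - k) = N - k + n by ring]
    field_simp
  rw [t1, t2, t3, t4]
  field_simp
  ring

/-! ### The three-term recurrence for the entries of `P_n L`. -/

section

/-- The coefficient of `L_{n+k,j}` in the `(k,j)` entry of `P_n L`. -/
def racahCoeff (N n k j : ℕ) : ℂ :=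
  poch (-N) j / poch (N + 2) j * ∑ i ∈ Finset.range (j + 1), dualPoch j i * racahTerm N n k i

lemma sum_dualPoch_mul (j : ℕ) (f : ℕ → ℂ) :
    (j * (j + 1) : ℂ) * ∑ i ∈ Finset.range (j + 1), dualPoch j i * f i =
      ∑ i ∈ Finset.range (j + 1),
        dualPoch j i * (i * (i + 1) * f i - if i = 0 then 0 else f (i - 1)) := by
  have h : ∑ i ∈ Finset.range (j + 1), dualPoch j (i + 1) * f i =
      ∑ i ∈ Finset.range (j + 1), dualPoch j i * (if i = 0 then 0 else f (i - 1)) := by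
    rw [Finset.sum_range_succ, dualPoch_eq_zero (Nat.lt_succ_self j), Finset.sum_range_succ']
    simp
  simp only [mul_sub, Finset.sum_sub_distrib]
  rw [← h, Finset.mul_sum, ← Finset.sum_sub_distrib]
  refine Finset.sum_congr rfl fun i _ => ?_
  rw [dualPoch_succ]
  ring

lemma racahCoeff_raise {N n k j : ℕ} (hj : j ≤ N) (hk : k ≤ N) :
    (((n + k : ℕ) + 1 : ℂ) * ((n + k : ℕ) + 2) - j * (j + 1)) / (2 * ((n + k : ℕ) + 1) ^ 2) *
        racahCoeff N n k j =
      racahCoeff N (n + 1) k j + upCoeff N n k * racahCoeff N n (k + 1) j := by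
  have hK : ((n + k : ℕ) : ℂ) + 1 ≠ 0 := Nat.cast_add_one_ne_zero _
  rw [div_mul_eq_mul_div, div_eq_iff (by simpa using hK)]
  simp only [racahCoeff]
  rw [mul_left_comm, mul_left_comm (upCoeff N n k), ← mul_add, mul_assoc]
  congr 1
  rw [sub_mul, sum_dualPoch_mul]
  simp only [Finset.mul_sum, ← Finset.sum_sub_distrib, ← Finset.sum_add_distrib, Finset.sum_mul]
  refine Finset.sum_congr rfl fun i hi => ?_
  have hi : i ≤ N := by
    have := Finset.mem_range.1 hi
    omega
  have h := racahTerm_raise (n := n) hi hk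
  push_cast
  linear_combination dualPoch j i * h

lemma racahCoeff_lower {N n k j : ℕ} (hj : j < n + k) (hk : k ≤ N) :
    ((n + k : ℕ) : ℂ) / (2 * ((n + k : ℕ) + 1)) * racahCoeff N n k j =
      downCoeff n k * racahCoeff N n (k - 1) j + prevCoeff N n k * racahCoeff N (n - 1) k j := by
  simp only [racahCoeff]
  rw [mul_left_comm, mul_left_comm (downCoeff n k), mul_left_comm (prevCoeff N n k), ← mul_add]
  congr 1
  simp only [Finset.mul_sum, ← Finset.sum_add_distrib]
  refine Finset.sum_congr rfl fun i hi => ?_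
  have hi : i ≤ j := Nat.lt_succ_iff.1 (Finset.mem_range.1 hi)
  rcases n with _ | n
  · have h := racahTerm_lower_zero (show i < k by omega) hk
    have h0 : prevCoeff N 0 k = 0 := by simp [prevCoeff]
    rw [zero_add, h0]
    linear_combination dualPoch j i * h
  · have h := racahTerm_lower_succ (show i ≤ n + k by omega) hk
    rw [Nat.add_sub_cancel]
    linear_combination dualPoch j i * h

/-- At `n = 0` the factors depending on `k` cancel for `i ≤ k`, leaving the sum of
`sum_dualPoch_div`. This is the initial condition `P_0 L = L`. -/
lemma racahCoeff_zero {N k j : ℕ} (hj : j ≤ k) (hk : k ≤ N) : racahCoeff N 0 k j = 1 := by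
  rw [← sum_dualPoch_div (hj.trans hk), racahCoeff]
  congr 1
  refine Finset.sum_congr rfl fun i hi => ?_
  have hi : i ≤ j := Nat.lt_succ_iff.1 (Finset.mem_range.1 hi)
  have f1 := factorial_ne_zero' k
  have f2 := factorial_ne_zero' N
  have f3 := factorial_ne_zero' (N - k)
  have f4 := factorial_ne_zero' (N - i)
  have f5 := factorial_ne_zero' (k - i)
  have f6 := factorial_ne_zero' i
  have g : (N : ℂ) + 1 ≠ 0 := Nat.cast_add_one_ne_zero N
  have g2 : (N : ℂ) + 1 - i ≠ 0 := by
    have := Nat.cast_add_one_ne_zero (R := ℂ) (N - i)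
    push_cast [show i ≤ N by omega] at this
    convert this using 1
    ring
  rw [racahTerm, show (k : ℤ) - i = (k - i : ℕ) by omega, invFac_natCast]
  simp only [add_zero, zero_add]
  rw [show N + 1 - i = N - i + 1 by omega, Nat.factorial_succ N, Nat.factorial_succ (N - i)]
  push_cast [show i ≤ N by omega]
  rw [show (N : ℂ) - i + 1 = N + 1 - i by ring]
  field_simp
  simp

/-- The entries of `L` as polynomials. -/
def Lpoly (k j : ℕ) : ℂ[X] := C (((2 * j + 1)! : ℂ) / (2 ^ j * (j ! : ℂ) ^ 2)) * ell k j

lemma Lpoly_eq_zero {k j : ℕ} (h : k < j) : Lpoly k j = 0 := by simp [Lpoly, ell_eq_zero h]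

lemma X_mul_Lpoly (n j : ℕ) :
    X * Lpoly n j =
      C (((n + 1 : ℂ) * (n + 2) - j * (j + 1)) / (2 * (n + 1) ^ 2)) * Lpoly (n + 1) j +
      C ((n : ℂ) / (2 * (n + 1))) * Lpoly (n - 1) j := by
  rw [Lpoly, mul_left_comm, X_mul_ell, Lpoly, Lpoly]
  ring

/-- The `(k,j)` entry of `P_n L`. -/
def rowPoly (N n k j : ℕ) : ℂ[X] := C (racahCoeff N n k j) * Lpoly (n + k) j

lemma rowPoly_zero {N k j : ℕ} (hk : k ≤ N) : rowPoly N 0 k j = Lpoly k j := by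
  rw [rowPoly, zero_add]
  rcases le_or_gt j k with h | h
  · rw [racahCoeff_zero h hk, C_1, one_mul]
  · rw [Lpoly_eq_zero h, mul_zero]

/-- The recurrence of `L_{n+k,j}` splits by level: the raised part is matched by `racahCoeff_raise`,
the lowered part by `racahCoeff_lower`. -/
lemma rowPoly_rec {N k j : ℕ} (n : ℕ) (hj : j ≤ N) (hk : k ≤ N) :
    X * rowPoly N n k j = rowPoly N (n + 1) k j + C (upCoeff N n k) * rowPoly N n (k + 1) j +
      C (downCoeff n k) * rowPoly N n (k - 1) j +
      C (prevCoeff N n k) * rowPoly N (n - 1) k j := by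
  have h1 : rowPoly N (n + 1) k j + C (upCoeff N n k) * rowPoly N n (k + 1) j =
      C (racahCoeff N n k j) *
        (C ((((n + k : ℕ) + 1 : ℂ) * ((n + k : ℕ) + 2) - j * (j + 1)) /
          (2 * ((n + k : ℕ) + 1) ^ 2)) * Lpoly (n + k + 1) j) := by
    rw [rowPoly, rowPoly, ← add_assoc, add_right_comm n 1 k, ← mul_assoc, ← mul_assoc, ← C_mul,
      ← C_mul, ← add_mul, ← C_add, ← racahCoeff_raise hj hk, mul_comm (racahCoeff _ _ _ _)]
  have h2 : C (downCoeff n k) * rowPoly N n (k - 1) j +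
      C (prevCoeff N n k) * rowPoly N (n - 1) k j = C (racahCoeff N n k j) *
        (C (((n + k : ℕ) : ℂ) / (2 * ((n + k : ℕ) + 1))) * Lpoly (n + k - 1) j) := by
    have hd : C (downCoeff n k) * rowPoly N n (k - 1) j =
        C (downCoeff n k * racahCoeff N n (k - 1) j) * Lpoly (n + k - 1) j := by
      rcases k with _ | k
      · simp [downCoeff]
      · simp [rowPoly, ← add_assoc, mul_assoc]
    have hp : C (prevCoeff N n k) * rowPoly N (n - 1) k j =
        C (prevCoeff N n k * racahCoeff N (n - 1) k j) * Lpoly (n + k - 1) j := by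
      rcases n with _ | n
      · simp [prevCoeff]
      · simp [rowPoly, show n + 1 + k - 1 = n + k by omega, mul_assoc]
    rw [hd, hp, ← add_mul, ← C_add, ← mul_assoc, ← C_mul, mul_comm (racahCoeff N n k j)]
    -- The lowering relation is available only for `j < n + k`; otherwise `L_{n+k-1,j}` is zero, or
    -- `n = k = 0` and all the coefficients vanish.
    rcases lt_or_ge j (n + k) with h | h
    · rw [racahCoeff_lower h hk]
    · rcases Nat.eq_zero_or_pos (n + k) with h0 | h0
      · obtain rfl : n = 0 := by omega
        obtain rfl : k = 0 := by omega
        simp [downCoeff, prevCoeff]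
      · rw [Lpoly_eq_zero (by omega), mul_zero, mul_zero]
  rw [add_assoc (_ + _), h1, h2, rowPoly, mul_left_comm, X_mul_Lpoly, mul_add]

variable {N : ℕ}

/-- The matrix of the entries of `L`. -/
def matL (N : ℕ) : Matrix (Fin (N + 1)) (Fin (N + 1)) ℂ[X] := Matrix.of fun k j => Lpoly k j

/-- The coefficient of `P_n` in the three term recurrence. -/
def stepMat (N n : ℕ) : Matrix (Fin (N + 1)) (Fin (N + 1)) ℂ :=
  Matrix.of fun k i => (if (i : ℕ) = k + 1 then upCoeff N n k else 0) +
    if (k : ℕ) = i + 1 then downCoeff n k else 0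

/-- The coefficient of `P_{n-1}` in the three term recurrence. -/
def prevMat (N n : ℕ) : Matrix (Fin (N + 1)) (Fin (N + 1)) ℂ :=
  Matrix.diagonal fun k => prevCoeff N n k

lemma sum_stepMat {M : Type*} [AddCommGroup M] [Module ℂ M] (n : ℕ) (k : Fin (N + 1))
    (f : ℕ → M) : ∑ i : Fin (N + 1), stepMat N n k i • f i =
      upCoeff N n k • f (k + 1) + downCoeff n k • f (k - 1) := by
  simp only [stepMat, Matrix.of_apply, add_smul, Finset.sum_add_distrib, ite_smul, zero_smul]
  rw [Fin.sum_univ_eq_sum_range (fun i => if i = (k : ℕ) + 1 then upCoeff N n k • f i else 0),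
    Fin.sum_univ_eq_sum_range (fun i => if (k : ℕ) = i + 1 then downCoeff n k • f i else 0),
    Finset.sum_ite_eq']
  congr 1
  · split_ifs with h
    · rfl
    · have : (k : ℕ) = N := by
        have := k.2
        simp at h
        omega
      simp [upCoeff, this]
  · rcases Nat.eq_zero_or_pos (k : ℕ) with h | h
    · simp [h, downCoeff]
    · rw [Finset.sum_eq_single ((k : ℕ) - 1)]
      · rw [if_pos (by omega)]
      · intro i _ hi
        rw [if_neg (by omega)]
      · intro hk
        have := k.2
        simp at hk

/-- The monic matrix-valued orthogonal polynomials, defined by their three term recurrence. -/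
def mvop (N : ℕ) : ℕ → Matrix (Fin (N + 1)) (Fin (N + 1)) ℂ[X]
  | 0 => 1
  | 1 => (X : ℂ[X]) • (1 : Matrix (Fin (N + 1)) (Fin (N + 1)) ℂ[X]) - (stepMat N 0).map C
  | n + 2 => (X : ℂ[X]) • mvop N (n + 1) - (stepMat N (n + 1)).map C * mvop N (n + 1) -
      (prevMat N (n + 1)).map C * mvop N n

lemma mvop_rec (n : ℕ) : (X : ℂ[X]) • mvop N n = mvop N (n + 1) +
    (stepMat N n).map C * mvop N n + (prevMat N n).map C * mvop N (n - 1) := by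
  rcases n with _ | n
  · have : prevMat N 0 = 0 := by simp [prevMat, prevCoeff]
    simp [mvop, this]
  · simp [mvop]
    abel

lemma stepMat_map_mul_apply (n : ℕ) (A : Matrix (Fin (N + 1)) (Fin (N + 1)) ℂ[X])
    (k j : Fin (N + 1)) (f : ℕ → ℂ[X]) (hf : ∀ i : Fin (N + 1), A i j = f i) :
    ((stepMat N n).map C * A) k j =
      C (upCoeff N n k) * f (k + 1) + C (downCoeff n k) * f (k - 1) := by
  simp only [← smul_eq_C_mul]
  rw [← sum_stepMat, Matrix.mul_apply]
  simp [smul_eq_C_mul, hf]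

lemma prevMat_map_mul_apply (n : ℕ) (A : Matrix (Fin (N + 1)) (Fin (N + 1)) ℂ[X])
    (k j : Fin (N + 1)) : ((prevMat N n).map C * A) k j = C (prevCoeff N n k) * A k j := by
  rw [prevMat, Matrix.diagonal_map (map_zero C), Matrix.diagonal_mul]

theorem mvop_mul_matL (n : ℕ) (k j : Fin (N + 1)) :
    (mvop N n * matL N) k j = rowPoly N n k j := by
  have hN : ∀ k : Fin (N + 1), (k : ℕ) ≤ N := fun k => Nat.lt_succ_iff.1 k.2
  induction n using Nat.strong_induction_on generalizing k j with
  | _ n ih =>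
    rcases n with _ | n
    · simp [mvop, matL, rowPoly_zero (hN k)]
    · have h := congr_arg (fun A => (A * matL N) k j) (mvop_rec (N := N) n)
      simp only [add_mul, Matrix.add_apply, Matrix.smul_mul, Matrix.smul_apply,
        Matrix.mul_assoc] at h
      rw [stepMat_map_mul_apply n _ k j (fun k => rowPoly N n k j) (fun i => ih n (by omega) i j),
        prevMat_map_mul_apply, ih n (by omega), ih (n - 1) (by omega), smul_eq_mul,
        rowPoly_rec n (hN j) (hN k)] at h
      linear_combination -h

end

/-! ### Orthogonality, norms and uniqueness. -/

section

/-- The entries of `T Lᵗ`, without the factor `√(1-x²)`. -/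
def matTL (N j i : ℕ) : ℂ[X] :=
  C (((N ! : ℂ) ^ 2)⁻¹ * ((2 * j + 1) * (N + j + 1)! * (N - j)!) *
    (2 ^ j * (j ! : ℂ) ^ 2 / (2 * j + 1)!)) * (1 - X ^ 2) ^ j * ell i j

lemma X_mul_matTL (N j i : ℕ) : X * matTL N j (i + 1) =
    C ((((i + 1 : ℕ) + 1 : ℂ) * ((i + 1 : ℕ) + 2) - j * (j + 1)) /
      (2 * ((i + 1 : ℕ) + 1) ^ 2)) * matTL N j (i + 2) +
    C (((i + 1 : ℕ) : ℂ) / (2 * ((i + 1 : ℕ) + 1))) * matTL N j i := by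
  rw [matTL, mul_left_comm, X_mul_ell, matTL, matTL, Nat.add_sub_cancel]
  ring

variable {N : ℕ}

lemma polyW_apply (k i : Fin (N + 1)) :
    polyW N k i = ∑ j : Fin (N + 1), matL N k j * matTL N j i := by
  simp only [matL, Matrix.of_apply]
  rw [Fin.sum_univ_eq_sum_range (fun j => Lpoly k j * matTL N j i), polyW, Matrix.of_apply, ldu,
    Finset.mul_sum]
  refine Finset.sum_congr rfl fun j _ => ?_
  have f1 := factorial_ne_zero' j
  have f2 := factorial_ne_zero' (2 * j + 1)
  have h : ((2 * j + 1)! : ℂ) / (2 ^ j * (j ! : ℂ) ^ 2) *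
      (2 ^ j * (j ! : ℂ) ^ 2 / (2 * j + 1)!) = 1 := by
    field_simp
  have h' := congr_arg C h
  rw [C_mul, C_1] at h'
  rw [Lpoly, matTL]
  simp only [C_mul] at h' ⊢
  linear_combination -(C ((N ! : ℂ) ^ 2)⁻¹ * (C (2 * j + 1 : ℂ) * C ((N + j + 1)! : ℂ) *
    C ((N - j)! : ℂ)) * (1 - X ^ 2) ^ j * ell k j * ell i j) * h'

/-- The moments of `P_n`, as a function of arbitrary indices. -/
def levelMoment (N n k i : ℕ) : ℂ :=
  ∑ j : Fin (N + 1), semicircle (rowPoly N n k j * matTL N j i)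

lemma semicircle_rowPoly_mul_matTL {N n k i : ℕ} (j : ℕ) (h : n + k ≠ i) :
    semicircle (rowPoly N n k j * matTL N j i) = 0 := by
  simp only [rowPoly, Lpoly, matTL, ell]
  have e : ∀ a b c d e : ℂ, ∀ f g w : ℂ[X], C a * (C b * (C c * f)) * (C d * w * (C e * g)) =
      C (a * b * c * d * e) * (w * f * g) := fun a b c d e f g w => by
    simp only [C_mul]; ring
  rw [e, semicircle_C_mul, semicircle_dU_mul_dU j h, mul_zero]

lemma levelMoment_eq_zero {N n k i : ℕ} (h : n + k ≠ i) : levelMoment N n k i = 0 :=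
  Finset.sum_eq_zero fun j _ => semicircle_rowPoly_mul_matTL j h

lemma moment_mvop_apply (n : ℕ) (k i : Fin (N + 1)) :
    moment (mvop N n) k i = levelMoment N n k i := by
  rw [moment, Matrix.map_apply, levelMoment, ← map_sum]
  congr 1
  simp only [← mvop_mul_matL, Matrix.mul_apply, polyW_apply, Finset.mul_sum, Finset.sum_mul]
  rw [Finset.sum_comm]
  simp only [mul_assoc]

/-- Evaluate `∫ x P_n W` in column `n + k + 1` twice: let `x` act on the factor `T Lᵗ`, then on the
row through `rowPoly_rec`. Orthogonality leaves one term on the first side and two on the second. -/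
lemma levelMoment_rec (n : ℕ) {k : ℕ} (hk : k ≤ N) :
    ((n + k + 1 : ℕ) : ℂ) / (2 * ((n + k + 1 : ℕ) + 1)) * levelMoment N n k (n + k) =
      levelMoment N (n + 1) k (n + k + 1) +
        upCoeff N n k * levelMoment N n (k + 1) (n + k + 1) := by
  have h1 : ∑ j : Fin (N + 1), semicircle (X * rowPoly N n k j * matTL N j (n + k + 1)) =
      ((n + k + 1 : ℕ) : ℂ) / (2 * ((n + k + 1 : ℕ) + 1)) * levelMoment N n k (n + k) := by
    rw [levelMoment, Finset.mul_sum]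
    refine Finset.sum_congr rfl fun j _ => ?_
    rw [mul_comm X, mul_assoc, X_mul_matTL, mul_add, map_add, mul_left_comm, semicircle_C_mul,
      semicircle_rowPoly_mul_matTL _ (by omega), mul_zero, zero_add, mul_left_comm,
      semicircle_C_mul]
  have h2 : ∑ j : Fin (N + 1), semicircle (X * rowPoly N n k j * matTL N j (n + k + 1)) =
      levelMoment N (n + 1) k (n + k + 1) +
        upCoeff N n k * levelMoment N n (k + 1) (n + k + 1) +
        downCoeff n k * levelMoment N n (k - 1) (n + k + 1) +
        prevCoeff N n k * levelMoment N (n - 1) k (n + k + 1) := by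
    simp only [levelMoment, Finset.mul_sum, ← Finset.sum_add_distrib]
    refine Finset.sum_congr rfl fun j _ => ?_
    rw [rowPoly_rec n (Nat.lt_succ_iff.1 j.2) hk]
    simp only [add_mul, map_add, mul_assoc, semicircle_C_mul]
  rw [← h1, h2, levelMoment_eq_zero (k := k - 1) (by omega),
    levelMoment_eq_zero (n := n - 1) (by omega)]
  ring

lemma semicircle_ldu_self {k : ℕ} (hk : k ≤ N) :
    semicircle (C ((N ! : ℂ) ^ 2)⁻¹ * ldu N k k) =
      ((Real.pi / 2 * (N + 1) ^ 2 / ((k + 1) * (N + 1 - k)) : ℝ) : ℂ) := by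
  rw [ldu_eq_chebEntry hk hk, semicircle_C_mul, chebEntry, semicircle_C_mul, chebSum, map_sum,
    Finset.sum_range_succ, Finset.sum_eq_zero, zero_add]
  · rw [semicircle_C_mul, show (k : ℤ) + k - 2 * k = 0 by ring, U_zero, semicircle_one, chebCoeff,
      show (k : ℤ) + k + 1 - k = (k + 1 : ℕ) by push_cast; ring,
      show (N : ℤ) + 1 - k = (N - k + 1 : ℕ) by omega,
      show (N : ℤ) - (k + k) + k = (N - k : ℕ) by omega]
    simp only [invFac_natCast]
    have f1 := factorial_ne_zero' N
    have f2 := factorial_ne_zero' (N - k)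
    have f3 := factorial_ne_zero' k
    have g : (k : ℂ) + 1 ≠ 0 := Nat.cast_add_one_ne_zero k
    have g2 : (N : ℂ) + 1 - k ≠ 0 := by
      have := Nat.cast_add_one_ne_zero (R := ℂ) (N - k)
      push_cast [hk] at this
      convert this using 1
      ring
    rw [Nat.factorial_succ N, Nat.factorial_succ k, Nat.factorial_succ (N - k)]
    push_cast [hk]
    rw [show (N : ℂ) - k + 1 = N + 1 - k by ring]
    field_simp
  · intro t ht
    have ht : t < k := Finset.mem_range.1 ht
    obtain ⟨r, hr⟩ : ∃ r : ℕ, (k : ℤ) + k - 2 * t = r := ⟨2 * k - 2 * t, by omega⟩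
    rw [semicircle_C_mul, hr, semicircle_U (by omega), mul_zero]

lemma levelMoment_zero_self {k : ℕ} (hk : k ≤ N) : levelMoment N 0 k k =
    ((Real.pi / 2 * (N + 1) ^ 2 / ((k + 1) * (N + 1 - k)) : ℝ) : ℂ) := by
  have h := moment_mvop_apply (N := N) 0 ⟨k, by omega⟩ ⟨k, by omega⟩
  rw [← h, ← semicircle_ldu_self hk]
  simp [moment, mvop, polyW]

/-- The explicit diagonal moments of `W` make the two known terms of `levelMoment_rec` cancel at `n
= 0`; for larger `n` the recurrence propagates zero. -/
lemma levelMoment_succ (n : ℕ) {k : ℕ} (hk : n + 1 + k ≤ N) :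
    levelMoment N (n + 1) k (n + 1 + k) = 0 := by
  induction n generalizing k with
  | zero =>
    have h := levelMoment_rec 0 (show k ≤ N by omega)
    rw [zero_add, levelMoment_zero_self (by omega), zero_add, levelMoment_zero_self (by omega)] at h
    rw [zero_add, add_comm 1 k]
    have e : ((k + 1 : ℕ) : ℂ) / (2 * ((k + 1 : ℕ) + 1)) *
        ((Real.pi / 2 * (N + 1) ^ 2 / ((k + 1) * (N + 1 - k)) : ℝ) : ℂ) =
        upCoeff N 0 k *
          ((Real.pi / 2 * (N + 1) ^ 2 / (((k + 1 : ℕ) + 1) * (N + 1 - (k + 1 : ℕ))) : ℝ) : ℂ) := by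
      have g1 : (k : ℂ) + 1 ≠ 0 := Nat.cast_add_one_ne_zero k
      have g2 : (k : ℂ) + 1 + 1 ≠ 0 := by exact_mod_cast Nat.cast_add_one_ne_zero (R := ℂ) (k + 1)
      have g3 : (N : ℂ) - k + 1 ≠ 0 := by
        simpa [show k ≤ N by omega] using Nat.cast_add_one_ne_zero (R := ℂ) (N - k)
      have g4 : (N : ℂ) - k ≠ 0 := by
        rw [sub_ne_zero]
        exact_mod_cast (show N ≠ k by omega)
      rw [upCoeff]
      push_cast
      rw [show (N : ℂ) + 1 - k = N - k + 1 by ring, show (N : ℂ) + 1 - (k + 1) = N - k by ring,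
        zero_add]
      field_simp
    rw [e] at h
    linear_combination -h
  | succ n ih =>
    have h := levelMoment_rec (n + 1) (show k ≤ N by omega)
    rw [ih (by omega), show n + 1 + k + 1 = n + 1 + (k + 1) by ring, ih (by omega)] at h
    rw [show n + 1 + 1 + k = n + 1 + (k + 1) by ring]
    simpa using h.symm

lemma moment_mvop_succ (n : ℕ) : moment (mvop N (n + 1)) = 0 := by
  ext k i
  rw [moment_mvop_apply, Matrix.zero_apply]
  by_cases h : n + 1 + (k : ℕ) = i
  · rw [← h]
    exact levelMoment_succ n (by omega)
  · exact levelMoment_eq_zero h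

/-- The diagonal entries of the squared norm of `P_n`. -/
def normSq (N : ℕ) : ℕ → ℕ → ℝ
  | 0, k => Real.pi / 2 * (N + 1) ^ 2 / ((k + 1) * (N + 1 - k))
  | n + 1, k => (n + 1) ^ 2 * (N + n + 2) ^ 2 / (4 * (n + 1 + k) * (n + 2 + k) *
      (n + 1 + (N - k)) * (n + 2 + (N - k))) * normSq N n k

lemma normSq_pos (n : ℕ) {k : ℕ} (hk : k ≤ N) : 0 < normSq N n k := by
  have h : (0 : ℝ) ≤ N - k := by
    rw [sub_nonneg]
    exact_mod_cast hk
  induction n with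
  | zero =>
    have : (0 : ℝ) < N + 1 - k := by linarith
    rw [normSq]
    positivity
  | succ n ih =>
    rw [normSq]
    positivity

/-- The squared norm of `P_n`. -/
def normMat (N n : ℕ) : Matrix (Fin (N + 1)) (Fin (N + 1)) ℂ :=
  Matrix.diagonal fun k => (normSq N n k : ℂ)

lemma normMat_posDef (n : ℕ) : (normMat N n).PosDef := by
  rw [normMat, Matrix.posDef_diagonal_iff]
  intro k
  exact_mod_cast normSq_pos n (Nat.lt_succ_iff.1 k.2)

lemma moment_mvop_zero : moment (mvop N 0) = normMat N 0 := by
  ext k i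
  rw [moment_mvop_apply, normMat, Matrix.diagonal_apply]
  split_ifs with h
  · subst h
    rw [levelMoment_zero_self (Nat.lt_succ_iff.1 k.2), normSq]
  · exact levelMoment_eq_zero (by simpa [Fin.ext_iff] using h)

lemma prevMat_mul_normMat (n : ℕ) : prevMat N (n + 1) * normMat N n = normMat N (n + 1) := by
  rw [prevMat, normMat, Matrix.diagonal_mul_diagonal, normMat]
  congr 1
  ext k
  rw [normSq, prevCoeff]
  push_cast
  ring

/-- Each factor `x` is absorbed by the three-term recurrence. Only the `P_{n-1}` branch can reach
the diagonal case, and there the norms satisfy `H_n = prevMat N n * H_{n-1}`. -/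
lemma moment_X_pow_mvop (m n : ℕ) (h : m ≤ n) :
    moment ((X : ℂ[X]) ^ m • mvop N n) = if m = n then normMat N n else 0 := by
  induction m generalizing n with
  | zero =>
    rcases n with _ | n
    · simp [moment_mvop_zero]
    · simp [moment_mvop_succ]
  | succ m ih =>
    obtain ⟨n, rfl⟩ : ∃ n', n = n' + 1 := ⟨n - 1, by omega⟩
    rw [pow_succ, mul_smul, mvop_rec, smul_add, smul_add, moment_add, moment_add, ← Matrix.mul_smul,
      ← Matrix.mul_smul, moment_C_mul, moment_C_mul, ih (n + 1 + 1) (by omega),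
      ih (n + 1) (by omega), ih (n + 1 - 1) (by omega), if_neg (show m ≠ n + 1 + 1 by omega),
      if_neg (show m ≠ n + 1 by omega), Nat.add_sub_cancel]
    by_cases hm : m = n
    · simp [hm, prevMat_mul_normMat]
    · simp [hm]

lemma innerW_mvop_left {n : ℕ} (Q : Matrix (Fin (N + 1)) (Fin (N + 1)) ℂ[X])
    (hQ : ∀ i j, (Q i j).natDegree ≤ n) :
    innerW (mvop N n) Q = normMat N n * (Q.map fun p => p.coeff n)ᴴ := by
  rw [innerW_eq_sum _ _ hQ, Finset.sum_range_succ, Finset.sum_eq_zero, zero_add,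
    moment_X_pow_mvop n n le_rfl, if_pos rfl]
  intro m hm
  have hm : m < n := Finset.mem_range.1 hm
  rw [moment_X_pow_mvop m n hm.le, if_neg hm.ne, zero_mul]

lemma mvop_natDegree_coeff (n : ℕ) : (∀ i j, (mvop N n i j).natDegree ≤ n) ∧
    (mvop N n).map (fun p => p.coeff n) = 1 := by
  induction n using Nat.strong_induction_on with
  | _ n ih =>
    rcases n with _ | n
    · refine ⟨fun i j => ?_, ?_⟩
      · by_cases h : i = j <;> simp [mvop, Matrix.one_apply, h]
      · ext i j
        by_cases h : i = j <;> simp [mvop, Matrix.one_apply, h]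
    · have hrec : ∀ k j, mvop N (n + 1) k j = X * mvop N n k j -
          ∑ i, C (stepMat N n k i) * mvop N n i j - C (prevCoeff N n k) * mvop N (n - 1) k j := by
        intro k j
        have h := congr_arg (fun A => A k j) (mvop_rec (N := N) n)
        simp only [Matrix.add_apply, Matrix.smul_apply, smul_eq_mul, prevMat_map_mul_apply] at h
        rw [Matrix.mul_apply] at h
        simp only [Matrix.map_apply] at h
        linear_combination -h
      obtain ⟨hd, hc⟩ := ih n (by omega)
      have hlow : ∀ k j, (∑ i, C (stepMat N n k i) * mvop N n i j +
          C (prevCoeff N n k) * mvop N (n - 1) k j).natDegree ≤ n := by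
        intro k j
        refine natDegree_add_le_of_degree_le (natDegree_sum_le_of_forall_le _ _ fun i _ => ?_) ?_
        · exact (natDegree_C_mul_le _ _).trans (hd i j)
        · refine (natDegree_C_mul_le _ _).trans ?_
          exact ((ih (n - 1) (by omega)).1 k j).trans (by omega)
      refine ⟨fun k j => ?_, ?_⟩
      · rw [hrec, sub_sub]
        refine (natDegree_sub_le _ _).trans (max_le ?_ ((hlow k j).trans n.le_succ))
        refine natDegree_mul_le.trans ?_
        have := hd k j
        rw [natDegree_X]
        omega
      · ext k j
        have h := congr_arg (fun A => A k j) hc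
        simp only [Matrix.map_apply] at h ⊢
        rw [hrec, sub_sub, coeff_sub, coeff_X_mul, h,
          coeff_eq_zero_of_natDegree_lt (Nat.lt_succ_of_le (hlow k j)), sub_zero]

theorem isMonicMVOP_mvop : IsMonicMVOP N (mvop N) where
  natDegree_le n := (mvop_natDegree_coeff n).1
  monic n := (mvop_natDegree_coeff n).2
  orthogonal := by
    have hlt : ∀ n m, m < n → innerW (mvop N n) (mvop N m) = 0 := fun n m h => by
      have hd := (mvop_natDegree_coeff (N := N) m).1
      rw [innerW_mvop_left _ fun i j => (hd i j).trans h.le]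
      have : (mvop N m).map (fun p => p.coeff n) = 0 := by
        ext i j
        exact coeff_eq_zero_of_natDegree_lt ((hd i j).trans_lt h)
      rw [this, Matrix.conjTranspose_zero, mul_zero]
    refine ⟨normMat N, normMat_posDef, fun n m => ?_⟩
    split_ifs with h
    · subst h
      rw [innerW_mvop_left _ (mvop_natDegree_coeff n).1, (mvop_natDegree_coeff n).2,
        Matrix.conjTranspose_one, mul_one]
    · rcases lt_or_gt_of_ne h with h | h
      · rw [← innerW_conjTranspose, hlt m n h, Matrix.conjTranspose_zero]
      · exact hlt n m h

lemma innerW_sub_right (P Q R : Matrix (Fin (N + 1)) (Fin (N + 1)) ℂ[X]) :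
    innerW P (Q - R) = innerW P Q - innerW P R := by
  ext i j
  have h : conjMat (Q - R) = conjMat Q - conjMat R := by
    ext1 i j
    simp [conjMat]
  simp [innerW_apply, h, Matrix.transpose_sub, mul_sub]

/-- The difference of the two degree-`n` members has no leading term and is orthogonal to all lower
`mvop N m`. Pairing with `mvop N d` reads off its degree-`d` coefficient, up to an invertible norm,
so the coefficients vanish from the top down. -/
theorem IsMonicMVOP.eq_mvop {P : ℕ → Matrix (Fin (N + 1)) (Fin (N + 1)) ℂ[X]}
    (hP : IsMonicMVOP N P) (n : ℕ) : P n = mvop N n := by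
  obtain ⟨H, -, hH⟩ := hP.orthogonal
  obtain ⟨H', -, hH'⟩ := (isMonicMVOP_mvop (N := N)).orthogonal
  induction n using Nat.strong_induction_on with
  | _ n ih =>
    set D := P n - mvop N n with hD
    have horth : ∀ m < n, innerW (mvop N m) D = 0 := fun m hm => by
      rw [hD, innerW_sub_right, hH', if_neg hm.ne, ← ih m hm, hH, if_neg hm.ne, sub_zero]
    have hcoeff : ∀ m ≤ n, D.map (fun p => p.coeff (n - m)) = 0 ∧
        ∀ i j, (D i j).natDegree ≤ n - m := by
      intro m hm
      induction m with
      | zero =>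
        refine ⟨?_, fun i j => ?_⟩
        · have h1 := hP.monic n
          have h2 := (isMonicMVOP_mvop (N := N)).monic n
          have : D.map (fun p => p.coeff (n - 0)) =
              (P n).map (fun p => p.coeff n) - (mvop N n).map (fun p => p.coeff n) := by
            ext i j
            simp [hD]
          rw [this, h1, h2, sub_self]
        · simpa [hD] using natDegree_sub_le_of_le (hP.natDegree_le n i j)
            (isMonicMVOP_mvop.natDegree_le n i j)
      | succ m ihm =>
        obtain ⟨h0, hd⟩ := ihm (by omega)
        have hd' : ∀ i j, (D i j).natDegree ≤ n - (m + 1) := fun i j => by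
          by_contra! hlt
          have hdeg : (D i j).natDegree = n - m := le_antisymm (hd i j) (by omega)
          have hz : (D i j).coeff (n - m) = 0 := congr_arg (fun A => A i j) h0
          rw [← hdeg] at hz
          have : D i j = 0 := leadingCoeff_eq_zero.1 hz
          rw [this, natDegree_zero] at hlt
          omega
        refine ⟨?_, hd'⟩
        have h1 := innerW_mvop_left D hd'
        rw [horth _ (by omega)] at h1
        have h2 := (normMat_posDef (N := N) (n - (m + 1))).isUnit
        have h3 := h2.mul_right_eq_zero.1 h1.symm
        exact Matrix.conjTranspose_eq_zero.1 h3
    have hz : D = 0 := by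
      ext1 i j
      obtain ⟨h0, hd⟩ := hcoeff n le_rfl
      rw [Nat.sub_self] at h0 hd
      rw [eq_C_of_natDegree_eq_zero (Nat.le_zero.1 (hd i j))]
      have : (D i j).coeff 0 = 0 := congr_arg (fun A => A i j) h0
      simp [this]
    exact sub_eq_zero.1 hz

end

/-! ### Gegenbauer, Racah and hypergeometric forms. -/

section

lemma ordinaryHypergeometric_neg_nat (p : ℕ) (b c z : ℂ) :
    ordinaryHypergeometric (-(p : ℂ)) b c z =
      ∑ i ∈ Finset.range (p + 1), (i ! : ℂ)⁻¹ * poch (-p) i * poch b i * (poch c i)⁻¹ * z ^ i := by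
  rw [ordinaryHypergeometric_eq_tsum]
  refine (tsum_eq_sum (s := Finset.range (p + 1)) fun i hi => ?_).trans ?_
  · have h : poch (-p) i = 0 := poch_neg_eq_zero (by have := Finset.mem_range.not.1 hi; omega)
    rw [poch] at h
    simp [h]
  · simp [poch]

lemma eval_one_dU_succ (j : ℕ) (n : ℤ) :
    (2 * j + 3 : ℂ) * (dU (j + 1) n).eval 1 = ((n + 1) ^ 2 - (j + 1) ^ 2) * (dU j n).eval 1 :=
  Polynomial.Chebyshev.iterate_derivative_U_eval_one_recurrence n j

lemma two_mul_add_three_ne_zero (j : ℕ) : (2 * j + 3 : ℂ) ≠ 0 := by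
  exact_mod_cast (show 2 * j + 3 ≠ 0 by omega)

lemma eval_one_dU (p j : ℕ) :
    (dU j (p + j : ℕ)).eval 1 =
      2 ^ j * (j ! : ℂ) * (p + 2 * j + 1)! / ((2 * j + 1)! * p !) := by
  induction j generalizing p with
  | zero =>
    have := factorial_ne_zero' p
    simp [dU_zero, Nat.factorial_succ]
    field_simp
  | succ j ih =>
    have h := eval_one_dU_succ j (p + (j + 1) : ℕ)
    have h1 := ih (p + 1)
    rw [show p + 1 + j = p + (j + 1) by ring, show p + 1 + 2 * j + 1 = p + 2 * j + 2 by ring] at h1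
    rw [h1] at h
    have f1 := factorial_ne_zero' p
    have f2 := factorial_ne_zero' (2 * j + 1)
    have g1 := two_mul_add_three_ne_zero j
    have g2 : (p : ℂ) + 1 ≠ 0 := Nat.cast_add_one_ne_zero p
    have g3 : (2 * j + 1 + 1 : ℂ) ≠ 0 := by exact_mod_cast (show 2 * j + 1 + 1 ≠ 0 by omega)
    have g4 : (2 * j + 1 + 1 + 1 : ℂ) ≠ 0 := by
      exact_mod_cast (show 2 * j + 1 + 1 + 1 ≠ 0 by omega)
    apply mul_left_cancel₀ g1
    rw [h, show p + 2 * (j + 1) + 1 = p + 2 * j + 2 + 1 by ring,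
      show 2 * (j + 1) + 1 = 2 * j + 1 + 1 + 1 by ring, Nat.factorial_succ (p + 2 * j + 2),
      Nat.factorial_succ (2 * j + 1 + 1), Nat.factorial_succ (2 * j + 1), Nat.factorial_succ j,
      Nat.factorial_succ p]
    push_cast
    field_simp
    ring

lemma poch_add_half_ne_zero (j i : ℕ) : poch ((j : ℂ) + 1 + 1 / 2) i ≠ 0 := by
  induction i with
  | zero => simp [poch_zero]
  | succ i ih =>
    rw [poch_succ]
    refine mul_ne_zero ih fun h => two_mul_add_three_ne_zero (j + i) ?_
    push_cast
    linear_combination 2 * h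

lemma eval_one_dU_add (p j i : ℕ) :
    (dU (j + i) (p + j : ℕ)).eval 1 = (dU j (p + j : ℕ)).eval 1 *
      (poch (-p) i * poch (p + 2 * (j + 1)) i * (poch (j + 1 + 1 / 2) i)⁻¹ * (-1 / 2) ^ i) := by
  induction i with
  | zero => simp [poch_zero]
  | succ i ih =>
    have h := eval_one_dU_succ (j + i) (p + j : ℕ)
    have g := two_mul_add_three_ne_zero (j + i)
    have g2 := poch_add_half_ne_zero j i
    have g3 := poch_add_half_ne_zero j (i + 1)
    have g4 : (j : ℂ) + 1 + 1 / 2 + i ≠ 0 := fun h0 => by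
      rw [poch_succ, h0, mul_zero] at g3
      exact g3 rfl
    rw [ih] at h
    apply mul_left_cancel₀ g
    rw [← add_assoc, h, poch_succ, poch_succ, poch_succ]
    push_cast
    have e : (2 * ((j : ℂ) + i) + 3) = 2 * (j + 1 + 1 / 2 + i) := by ring
    rw [e, mul_inv, pow_succ]
    field_simp
    ring

/-- The terminating `₂F₁` is the Taylor expansion at `x = 1` of the derivative; the values at `1`
follow from the differential equation, whose leading term vanishes there. -/
lemma gegenbauer_eq (j p : ℕ) (x : ℂ) :
    gegenbauer (j + 1) p x = (dU j (p + j : ℕ)).eval x / (2 ^ j * j !) := by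
  have hdeg : (dU j (p + j : ℕ)).natDegree < p + 1 := by
    have h := natDegree_iterate_derivative (U ℂ (p + j : ℕ)) j
    rw [Polynomial.Chebyshev.natDegree_U_natCast] at h
    rw [dU]
    omega
  have htaylor : (dU j (p + j : ℕ)).eval x = ∑ i ∈ Finset.range (p + 1),
      (i ! : ℂ)⁻¹ * (dU (j + i) (p + j : ℕ)).eval 1 * (x - 1) ^ i := by
    rw [← taylor_eval_sub 1, eval_eq_sum_range' (by rwa [natDegree_taylor])]
    refine Finset.sum_congr rfl fun i _ => ?_
    congr 1
    rw [taylor_coeff]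
    have h := congr_arg (fun q : ℂ[X] => q.eval 1)
      (congr_fun (factorial_smul_hasseDeriv (R := ℂ) i) (dU j (p + j : ℕ)))
    have hd : derivative^[i] (dU j (p + j : ℕ)) = dU (j + i) (p + j : ℕ) := by
      rw [dU, dU, ← Function.iterate_add_apply, add_comm]
    beta_reduce at h
    rw [LinearMap.smul_apply, ← Nat.cast_smul_eq_nsmul ℂ, eval_smul, smul_eq_mul, hd] at h
    rw [← h, inv_mul_cancel_left₀ (factorial_ne_zero' i)]
  rw [gegenbauer, ordinaryHypergeometric_neg_nat, htaylor]
  simp only [eval_one_dU_add]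
  have f1 := factorial_ne_zero' p
  have f2 := factorial_ne_zero' j
  have f3 := factorial_ne_zero' (2 * j + 1)
  have h2 : poch (2 * (j + 1)) p = ((p + 2 * j + 1)! : ℂ) / (2 * j + 1)! := by
    have h := poch_natCast_add_one (2 * j + 1) p
    push_cast at h
    rw [show (2 * (j + 1) : ℂ) = 2 * j + 1 + 1 by ring, h,
      show 2 * j + 1 + p = p + 2 * j + 1 by ring]
  rw [h2, eval_one_dU, Finset.mul_sum, Finset.sum_div]
  refine Finset.sum_congr rfl fun i _ => ?_
  have hpow : ((1 - x) / 2) ^ i = (-1 / 2) ^ i * (x - 1) ^ i := by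
    rw [← mul_pow]
    congr 1
    ring
  rw [hpow]
  field_simp

lemma eval_Lpoly {m k : ℕ} (h : k ≤ m) (x : ℂ) :
    (Lpoly m k).eval x = (m ! : ℂ) * (2 * k + 1)! / ((m + k + 1)! * k !) *
      gegenbauer (k + 1) (m - k) x := by
  have f1 := factorial_ne_zero' k
  rw [gegenbauer_eq, Nat.sub_add_cancel h, Lpoly, ell, eval_C_mul, eval_C_mul]
  field_simp

variable {N : ℕ}

lemma evalMat_matL (x : ℂ) : evalMat (matL N) x = L N x := by
  ext m k
  simp only [evalMat, matL, L, Matrix.map_apply, Matrix.of_apply]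
  split_ifs with h
  · exact eval_Lpoly h x
  · rw [Lpoly_eq_zero (not_le.1 h), eval_zero]

lemma evalMat_mvop_mul_L (n : ℕ) (k j : Fin (N + 1)) (x : ℂ) :
    (evalMat (mvop N n) x * L N x) k j = racahCoeff N n k j * (Lpoly (n + k) j).eval x := by
  rw [← evalMat_matL, ← evalMat_mul, evalMat, Matrix.map_apply, mvop_mul_matL, rowPoly, eval_C_mul]

lemma hyp4F3_neg_nat (j : ℕ) (a₂ a₃ a₄ b₁ b₂ b₃ : ℂ) :
    hyp4F3 (-j) a₂ a₃ a₄ b₁ b₂ b₃ 1 = ∑ i ∈ Finset.range (j + 1),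
      (poch (-j) i * poch a₂ i * poch a₃ i * poch a₄ i) /
        (poch b₁ i * poch b₂ i * poch b₃ i * (i ! : ℂ)) := by
  refine (tsum_eq_sum (s := Finset.range (j + 1)) fun i hi => ?_).trans ?_
  · rw [poch_neg_eq_zero (by have := Finset.mem_range.not.1 hi; omega)]
    simp
  · simp

/-- Racah duality: with these parameters the two series agree term by term after permuting the upper
and lower parameters. -/
lemma racah_eq_hyp4F3 (N n k j : ℕ) :
    racah k j (-(N : ℂ) - 1) (-(k : ℂ) - n - 1) 0 0 =
      hyp4F3 (-j) (j + 1) (-k) (-(N : ℂ) - n - 1) 1 (-k - n) (-N) 1 := by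
  rw [racah, hyp4F3, hyp4F3]
  refine tsum_congr fun i => ?_
  rw [show (k : ℂ) + (-(N : ℂ) - 1) + (-(k : ℂ) - n - 1) + 1 = -(N : ℂ) - n - 1 by ring,
    show -(N : ℂ) - 1 + 1 = -N by ring, show -(k : ℂ) - n - 1 + 0 + 1 = -k - n by ring,
    show (j : ℂ) + 0 + 0 + 1 = j + 1 by ring, zero_add]
  congr 2 <;> ring

lemma poch_neg_eq {M i : ℕ} (h : i ≤ M) :
    poch (-M) i = (-1) ^ i * ((M ! : ℂ) / (M - i)!) := by
  have h1 := neg_one_pow_mul_poch_neg M i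
  rw [show (M : ℤ) - i = (M - i : ℕ) by omega, invFac_natCast, ← div_eq_mul_inv] at h1
  rw [← h1, ← mul_assoc, ← mul_pow]
  simp

lemma neg_two_pow_mul_c₀ {k : ℕ} (n : ℕ) (hk : k ≤ N) : (-2) ^ n * c₀ N k n =
    (n ! : ℂ) * (N + n + 1)! * k ! * (N - k)! / (2 ^ n * (N + 1)! * (n + k)! * (N - k + n)!) := by
  have h1 := poch_natCast_add_one (N + 1) n
  have h2 := poch_natCast_add_one k n
  have h3 := poch_natCast_add_one (N - k) n
  push_cast [hk] at h1 h3
  rw [show (N : ℂ) + 1 + 1 = N + 2 by ring] at h1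
  rw [c₀, h1, h2, h3, show N + 1 + n = N + n + 1 by ring, add_comm k n]
  have f1 := factorial_ne_zero' (N + 1)
  have f2 := factorial_ne_zero' k
  have f3 := factorial_ne_zero' (N - k)
  have h4 : (-2 : ℂ) ^ n * ((-1) ^ n * (4 ^ n)⁻¹) = (2 ^ n)⁻¹ := by
    rw [← mul_assoc, ← mul_pow, ← inv_pow, ← mul_pow, ← inv_pow]
    norm_num
  rw [← mul_assoc, h4]
  field_simp

lemma racahCoeff_eq {n k j : ℕ} (hj : j ≤ N) (hk : k ≤ N) :
    racahCoeff N n k j = poch (-N) j / poch (N + 2) j * ((-2) ^ n * c₀ N k n *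
      hyp4F3 (-j) (j + 1) (-k) (-(N : ℂ) - n - 1) 1 (-k - n) (-N) 1) := by
  rw [racahCoeff, hyp4F3_neg_nat, neg_two_pow_mul_c₀ n hk]
  congr 1
  rw [Finset.mul_sum]
  refine Finset.sum_congr rfl fun i hi => ?_
  have hi : i ≤ j := Nat.lt_succ_iff.1 (Finset.mem_range.1 hi)
  -- For `k < i` the numerator factor `(-k)_i` is zero, so a possible zero of `(-k-n)_i` in the
  -- denominator is harmless. For `i ≤ k` all denominators are nonzero.
  rcases lt_or_ge k i with h | h
  · rw [poch_neg_eq_zero h, racahTerm, invFac_of_neg (by omega)]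
    simp
  have h1 := poch_neg_eq (show i ≤ N + n + 1 by omega)
  have h2 := poch_neg_eq (show i ≤ n + k by omega)
  have h3 := poch_natCast_add_one 0 i
  push_cast at h1 h2 h3
  rw [show -((N : ℂ) + n + 1) = -N - n - 1 by ring] at h1
  rw [show -((n : ℂ) + k) = -k - n by ring] at h2
  rw [zero_add, zero_add] at h3
  rw [h1, h2, h3, poch_neg_eq h, poch_neg_eq (hi.trans hj), racahTerm, dualPoch,
    show (k : ℤ) - i = (k - i : ℕ) by omega, invFac_natCast]
  have f1 := factorial_ne_zero' (n + k)
  have f2 := factorial_ne_zero' (n + k - i)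
  have f3 := factorial_ne_zero' (N - i)
  have f4 := factorial_ne_zero' N
  have f5 := factorial_ne_zero' i
  have f6 : ((-1 : ℂ) ^ i) ≠ 0 := by simp
  simp only [Nat.factorial_zero, Nat.cast_one, div_one]
  field_simp

lemma gegenbauer_mul_factorial_div (j p : ℕ) (x : ℂ) :
    ((p ! : ℂ) / poch (2 * j + 2) p) * gegenbauer (j + 1) p x =
      ordinaryHypergeometric (-(p : ℂ)) (p + 2 * j + 2) (j + 3 / 2) ((1 - x) / 2) := by
  have h := poch_natCast_add_one (2 * j + 1) p
  push_cast at h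
  rw [show (2 * j + 1 + 1 : ℂ) = 2 * j + 2 by ring] at h
  have f1 := factorial_ne_zero' (2 * j + 1)
  have f2 := factorial_ne_zero' (2 * j + 1 + p)
  have f3 := factorial_ne_zero' p
  rw [gegenbauer, show 2 * ((j : ℂ) + 1) = 2 * j + 2 by ring,
    show (j : ℂ) + 1 + 1 / 2 = j + 3 / 2 by ring, ← add_assoc, h]
  field_simp

lemma racahCoeff_mul_eval_Lpoly {n k j : ℕ} (hj : j ≤ N) (hk : k ≤ N) (hjk : j ≤ k + n) (x : ℂ) :
    racahCoeff N n k j * (Lpoly (n + k) j).eval x =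
      (-2) ^ n * c₀ N k n * (-1) ^ j *
        (poch (-(N : ℂ)) j * poch (-k - n) j / ((j ! : ℂ) * poch (N + 2) j)) *
        racah k j (-(N : ℂ) - 1) (-k - n - 1) 0 0 *
        (((n + k - j)! : ℂ) / poch (2 * j + 2) (n + k - j)) *
        gegenbauer (j + 1) (n + k - j) x := by
  have h1 := poch_neg_eq (show j ≤ n + k by omega)
  have h2 := poch_natCast_add_one (2 * j + 1) (n + k - j)
  push_cast at h1 h2
  rw [show -((n : ℂ) + k) = -k - n by ring] at h1
  rw [show (2 * j + 1 + 1 : ℂ) = 2 * j + 2 by ring,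
    show 2 * j + 1 + (n + k - j) = n + k + j + 1 by omega] at h2
  rw [racahCoeff_eq hj hk, eval_Lpoly (by omega), racah_eq_hyp4F3, h1, h2]
  have f1 := factorial_ne_zero' j
  have f2 := factorial_ne_zero' (n + k - j)
  have f3 : ((-1 : ℂ) ^ j) * (-1) ^ j = 1 := by rw [← mul_pow]; simp
  field_simp
  -- The explicit sign `(-1)^j` cancels the one in `(-k-n)_j = (-1)^j (n+k)!/(n+k-j)!`.
  linear_combination -(poch (-(N : ℂ)) j * c₀ N k n *
    hyp4F3 (-j) (j + 1) (-k) (-(N : ℂ) - n - 1) 1 (-k - n) (-N) 1 *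
    gegenbauer (j + 1) (n + k - j) x * (poch (N + 2) j)⁻¹) * f3

lemma R_mul_M (P : ℕ → Matrix (Fin (N + 1)) (Fin (N + 1)) ℂ[X]) (n : ℕ) (k j : Fin (N + 1))
    (u : ℂ) : (R P n u * M N u) k j = ((-1 : ℂ) ^ n * ((2 : ℂ) ^ n)⁻¹) *
      (evalMat (P n) (1 - 2 * u) * L N (1 - 2 * u)) k j := by
  rw [R, M, Matrix.smul_mul, Matrix.smul_apply, smul_eq_mul]

end

end

end MVChebyshev

theorem theorem6p2 (N : ℕ) :
    (∃ P : ℕ → Matrix (Fin (N + 1)) (Fin (N + 1)) (Polynomial ℂ), MVChebyshev.IsMonicMVOP N P) ∧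
    ∀ P : ℕ → Matrix (Fin (N + 1)) (Fin (N + 1)) (Polynomial ℂ), MVChebyshev.IsMonicMVOP N P →
      ∀ (n : ℕ) (k j : Fin (N + 1)),
        -- the entries of `R_n(u) M(u)`
        (((j : ℕ) ≤ k + n → ∀ u : ℂ,
          (MVChebyshev.R P n u * MVChebyshev.M N u) k j =
            MVChebyshev.c₀ N k n * (-1) ^ (j : ℕ) *
              (MVChebyshev.poch (-(N : ℂ)) j * MVChebyshev.poch (-(k : ℕ) - n) j /
                (((j : ℕ)! : ℂ) * MVChebyshev.poch (N + 2) j)) *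
              MVChebyshev.hyp4F3 (-(j : ℕ)) ((j : ℕ) + 1) (-(k : ℕ)) (-(N : ℂ) - n - 1)
                1 (-(k : ℕ) - n) (-(N : ℂ)) 1 *
              ordinaryHypergeometric (((j : ℕ) : ℂ) - (k : ℕ) - n)
                ((n : ℂ) + (k : ℕ) + (j : ℕ) + 2) (((j : ℕ) : ℂ) + 3 / 2) u) ∧
        ((k : ℕ) + n < j → ∀ u : ℂ, (MVChebyshev.R P n u * MVChebyshev.M N u) k j = 0)) ∧
        -- the entries of `P_n(x) L(x)`, as a Racah polynomial times a Gegenbauer polynomial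
        (((j : ℕ) ≤ k + n → ∀ x : ℂ,
          (MVChebyshev.evalMat (P n) x * MVChebyshev.L N x) k j =
            (-2) ^ n * MVChebyshev.c₀ N k n * (-1) ^ (j : ℕ) *
              (MVChebyshev.poch (-(N : ℂ)) j * MVChebyshev.poch (-(k : ℕ) - n) j /
                (((j : ℕ)! : ℂ) * MVChebyshev.poch (N + 2) j)) *
              MVChebyshev.racah k j (-(N : ℂ) - 1) (-(k : ℕ) - n - 1) 0 0 *
              (((n + (k : ℕ) - (j : ℕ))! : ℂ) /
                MVChebyshev.poch (2 * (j : ℕ) + 2) (n + (k : ℕ) - (j : ℕ))) *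
              MVChebyshev.gegenbauer ((j : ℕ) + 1) (n + (k : ℕ) - (j : ℕ)) x) ∧
        ((k : ℕ) + n < j → ∀ x : ℂ,
          (MVChebyshev.evalMat (P n) x * MVChebyshev.L N x) k j = 0)) := by
  refine ⟨⟨MVChebyshev.mvop N, MVChebyshev.isMonicMVOP_mvop⟩, fun P hP n k j => ?_⟩
  have hj := Nat.lt_succ_iff.1 j.2
  have hk := Nat.lt_succ_iff.1 k.2
  have hentry : ∀ x : ℂ, (MVChebyshev.evalMat (P n) x * MVChebyshev.L N x) k j =
      MVChebyshev.racahCoeff N n k j * (MVChebyshev.Lpoly (n + k) j).eval x := fun x => by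
    rw [hP.eq_mvop n, MVChebyshev.evalMat_mvop_mul_L]
  refine ⟨⟨fun h u => ?_, fun h u => ?_⟩, fun h x => ?_, fun h x => ?_⟩
  · have h2 : ((-1 : ℂ) ^ n * ((2 : ℂ) ^ n)⁻¹) * (-2) ^ n = 1 := by
      rw [← inv_pow, ← mul_pow, ← mul_pow]
      norm_num
    have hp : ((n + k - j : ℕ) : ℂ) = n + (k : ℕ) - (j : ℕ) := by
      push_cast [show (j : ℕ) ≤ n + k by omega]
      ring
    have hg := MVChebyshev.gegenbauer_mul_factorial_div j (n + k - j) (1 - 2 * u)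
    rw [hp, show -((n : ℂ) + (k : ℕ) - (j : ℕ)) = ((j : ℕ) : ℂ) - (k : ℕ) - n by ring,
      show (n : ℂ) + (k : ℕ) - (j : ℕ) + 2 * (j : ℕ) + 2 = n + (k : ℕ) + (j : ℕ) + 2 by ring,
      show (1 - (1 - 2 * u)) / 2 = u by ring] at hg
    rw [MVChebyshev.R_mul_M, hentry, MVChebyshev.racahCoeff_mul_eval_Lpoly hj hk h, mul_assoc _ _
      (MVChebyshev.gegenbauer _ _ _), hg, MVChebyshev.racah_eq_hyp4F3]
    linear_combination (MVChebyshev.c₀ N k n * (-1) ^ (j : ℕ) *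
      (MVChebyshev.poch (-(N : ℂ)) j * MVChebyshev.poch (-(k : ℕ) - n) j /
        (((j : ℕ)! : ℂ) * MVChebyshev.poch (N + 2) j)) *
      MVChebyshev.hyp4F3 (-(j : ℕ)) ((j : ℕ) + 1) (-(k : ℕ)) (-(N : ℂ) - n - 1)
        1 (-(k : ℕ) - n) (-(N : ℂ)) 1 *
      ordinaryHypergeometric (((j : ℕ) : ℂ) - (k : ℕ) - n)
        ((n : ℂ) + (k : ℕ) + (j : ℕ) + 2) (((j : ℕ) : ℂ) + 3 / 2) u) * h2
  · rw [MVChebyshev.R_mul_M, hentry, MVChebyshev.Lpoly_eq_zero (by omega)]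
    simp
  · rw [hentry, MVChebyshev.racahCoeff_mul_eval_Lpoly hj hk h]
  · rw [hentry, MVChebyshev.Lpoly_eq_zero (by omega)]
    simp
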